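/- **Setting.** Let $g:\mathbb R\to\mathbb R$ be bounded and Lipschitz with $\mathbb E[g(z)]=0$ and $\mu_1:=\mathbb E[g'(z)]\neq 0$, where $z\sim\mathcal N(0,1)$; let $\sigma_\varepsilon^2\ge 0$ be a noise variance, let $\alpha,\beta,\tilde\eta>0$ and $\zeta\in[1/2,1)$, and put $\eta=\tilde\eta\,d^{\zeta}$ (here $\alpha=n/d$ and $\beta=m/d$ are the fixed ratios of sample size and width to the dimension $d$). Put $s=\tfrac12\mathbb E[(z^2-1)g(z)^2]$ (that is, $s=\tfrac12\mathbb E[h''(z)]$ for $h=g^2$, with the distributional second derivative), $$A=1+\frac{\eta^2}{d^2}\frac{\mu_1^2}{\alpha\beta^2}\big(\mathbb E[g(z)^2]+\sigma_\varepsilon^2\big),\qquad B=\frac{\eta^2}{d}\frac{\mu_1^4}{\alpha\beta^2}\Big(\alpha-\frac1d+\frac{2s}{\mu_1^2d}\Big),$$ and $\Gamma=A I_d+B\,w^*(w^*)^\top$ for a unit vector $w^*\in\mathbb R^d$. Let $\sigma:\mathbb R\to\mathbb R$ be Lipschitz, with Lipschitz constant $L$. Let $\rho=\mathcal N(0,I_d)$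 and let $T_0,T_1$ be the integral operators on $L^2(\rho)$ with kernels $$k_0(x,x')=\mathbb E_{w\sim\mathcal N(0,\frac1dI_d)}[\sigma(\langle w,x\rangle)\sigma(\langle w,x'\rangle)],\qquad k_1(x,x')=\mathbb E_{w\sim\mathcal N(0,\frac1d\Gamma)}[\sigma(\langle w,x\rangle)\sigma(\langle w,x'\rangle)].$$ For $R>0$ let $T_i^R$ be the integral operator with the truncated kernel $\mathbf 1_{\{\|x\|<R\}}\mathbf 1_{\{\|x'\|<R\}}k_i(x,x')$. Write $\lambda_0(T)\ge\lambda_1(T)\ge\dots\ge0$ for the eigenvalues, with multiplicity, of a compact positive self-adjoint operator $T$ (continued by $0$ if there are only finitely many positive ones). **Theorem.** There are $d_0\ge1$, constants $c_d>0$ and, for each $R>0$, constants $C_{d,R}>0$, all depending only on $g,\sigma_\varepsilon^2,\alpha,\beta,\tilde\eta,\zeta$ and the displayed indices (for $\zeta=1/2$ they can be chosen independent of $d$), such that the following holds for every $d\ge d_0$. 1. For all $L,S\ge 0$ and $\varepsilon>0$ there is a truncation radius $R>0$ such that for every unit vector $w^*\in\mathbb R^d$, every $L$-Lipschitz $\sigma$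 with $|\sigma(0)|\le S$ and every $j\ge0$, $$|\lambda_j(T_i)-\lambda_j(T_i^R)|\le\varepsilon\quad(i=0,1),\qquad c_d\,\lambda_j(T_0)\le\lambda_j(T_1)\le C_{d,R}\,\lambda_j(T_0)+\varepsilon .$$ In particular $c_d$ does not depend on $j,\varepsilon,R,\sigma,w^*$, and $C_{d,R}$ does not depend on $j,\sigma,w^*$, and on $\varepsilon$ only through $R$. 2. The spectra of $T_0$ and $T_1$ have the same asymptotic decay rate on the logarithmic scale: for every unit $w^*$ and every Lipschitz $\sigma$, $\lambda_j(T_0)=0$ if and only if $\lambda_j(T_1)=0$, and $\log\lambda_j(T_1)=\Theta(\log\lambda_j(T_0))$ as $j\to\infty$ (with the convention $\log 0=0$). -/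

import Mathlib

open MeasureTheory ProbabilityTheory Filter
open scoped NNReal RealInnerProductSpace Matrix

noncomputable section

section IntegralOperator

variable {X : Type*} [MeasurableSpace X] {μ : Measure X}

theorem kernel_section_memLp [SFinite μ] {k : X → X → ℝ}
    (hk : MemLp (Function.uncurry k) 2 (μ.prod μ)) : ∀ᵐ x ∂μ, MemLp (k x) 2 μ := by
  filter_upwards [hk.integrable_sq.prod_right_ae, hk.1.prodMk_left] with x h1 h2
  exact (memLp_two_iff_integrable_sq h2).2 h1

theorem kernel_integrable_sq [SFinite μ] {k : X → X → ℝ}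
    (hk : MemLp (Function.uncurry k) 2 (μ.prod μ)) :
    Integrable (fun x => ∫ y, k x y ^ 2 ∂μ) μ :=
  hk.integrable_sq.integral_prod_left

theorem kernel_cauchy_schwarz {u v : X → ℝ} (hu : MemLp u 2 μ) (hv : MemLp v 2 μ) :
    (∫ y, u y * v y ∂μ) ^ 2 ≤ (∫ y, u y ^ 2 ∂μ) * ∫ y, v y ^ 2 ∂μ := by
  have hin : ∀ {a b : X → ℝ} (ha : MemLp a 2 μ) (hb : MemLp b 2 μ),
      ⟪ha.toLp a, hb.toLp b⟫ = ∫ y, a y * b y ∂μ := by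
    intro a b ha hb
    rw [L2.inner_def]
    refine integral_congr_ae ?_
    filter_upwards [ha.coeFn_toLp, hb.coeFn_toLp] with y h1 h2
    simp [h1, h2, mul_comm]
  have h := real_inner_mul_inner_self_le (hu.toLp u) (hv.toLp v)
  simp only [hin, ← sq] at h
  exact h

theorem integralOp_aestronglyMeasurable [SFinite μ] {k : X → X → ℝ}
    (hk : MemLp (Function.uncurry k) 2 (μ.prod μ)) (f : Lp ℝ 2 μ) :
    AEStronglyMeasurable (fun x => ∫ y, k x y * f y ∂μ) μ :=
  (hk.1.mul (Lp.aestronglyMeasurable f).comp_snd).integral_prod_right'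

theorem integralOp_sq_le [SFinite μ] {k : X → X → ℝ}
    (hk : MemLp (Function.uncurry k) 2 (μ.prod μ)) (f : Lp ℝ 2 μ) :
    ∀ᵐ x ∂μ, (∫ y, k x y * f y ∂μ) ^ 2 ≤ (∫ y, k x y ^ 2 ∂μ) * ‖f‖ ^ 2 := by
  have hf : ‖f‖ ^ 2 = ∫ y, f y ^ 2 ∂μ := by
    rw [← real_inner_self_eq_norm_sq, L2.inner_def]
    exact integral_congr_ae (ae_of_all _ fun y => by simp [sq])
  filter_upwards [kernel_section_memLp hk] with x hx
  rw [hf]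
  exact kernel_cauchy_schwarz hx (Lp.memLp f)

theorem integralOp_memLp [SFinite μ] {k : X → X → ℝ}
    (hk : MemLp (Function.uncurry k) 2 (μ.prod μ)) (f : Lp ℝ 2 μ) :
    MemLp (fun x => ∫ y, k x y * f y ∂μ) 2 μ := by
  have hm := integralOp_aestronglyMeasurable hk f
  refine (memLp_two_iff_integrable_sq hm).2 ?_
  refine ((kernel_integrable_sq hk).mul_const (‖f‖ ^ 2)).mono' (hm.pow 2) ?_
  filter_upwards [integralOp_sq_le hk f] with x hx
  simpa using hx

/-- The integral operator `(T f)(x) = ∫ k(x, y) f(y) dμ(y)` on `L²(μ)`,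
for a square-integrable kernel `k`. -/
def integralOp [SFinite μ] (k : X → X → ℝ)
    (hk : MemLp (Function.uncurry k) 2 (μ.prod μ)) : Lp ℝ 2 μ →L[ℝ] Lp ℝ 2 μ :=
  LinearMap.mkContinuous
    { toFun := fun f => (integralOp_memLp hk f).toLp _
      map_add' := fun f g => by
        rw [← MemLp.toLp_add]
        refine MemLp.toLp_congr _ _ ?_
        filter_upwards [kernel_section_memLp hk] with x hx
        have h1 : Integrable (fun y => k x y * f y) μ := hx.integrable_mul (Lp.memLp f)
        have h2 : Integrable (fun y => k x y * g y) μ := hx.integrable_mul (Lp.memLp g)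
        simp only [Pi.add_apply]
        rw [← integral_add h1 h2]
        refine integral_congr_ae ?_
        filter_upwards [Lp.coeFn_add f g] with y hy
        rw [hy, Pi.add_apply, mul_add]
      map_smul' := fun c f => by
        rw [RingHom.id_apply, ← MemLp.toLp_const_smul]
        refine MemLp.toLp_congr _ _ (ae_of_all _ fun x => ?_)
        simp only [Pi.smul_apply, smul_eq_mul]
        rw [← integral_const_mul]
        refine integral_congr_ae ?_
        filter_upwards [Lp.coeFn_smul c f] with y hy
        rw [hy, Pi.smul_apply, smul_eq_mul]
        ring }
    (Real.sqrt (∫ x, ∫ y, k x y ^ 2 ∂μ ∂μ)) (fun f => by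
      have h0 : 0 ≤ ∫ x, ∫ y, k x y ^ 2 ∂μ ∂μ :=
        integral_nonneg fun x => integral_nonneg fun y => sq_nonneg _
      refine le_of_sq_le_sq ?_ (by positivity)
      rw [mul_pow, Real.sq_sqrt h0, ← real_inner_self_eq_norm_sq, L2.inner_def,
        ← integral_mul_const]
      refine integral_mono_ae (L2.integrable_inner _ _)
        ((kernel_integrable_sq hk).mul_const _) ?_
      filter_upwards [integralOp_sq_le hk f, (integralOp_memLp hk f).coeFn_toLp] with x h1 h2
      simp only [LinearMap.coe_mk, AddHom.coe_mk]
      rw [h2]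
      simpa [sq] using h1)

theorem integralOp_apply_ae [SFinite μ] (k : X → X → ℝ)
    (hk : MemLp (Function.uncurry k) 2 (μ.prod μ)) (f : Lp ℝ 2 μ) :
    integralOp k hk f =ᵐ[μ] fun x => ∫ y, k x y * f y ∂μ :=
  (integralOp_memLp hk f).coeFn_toLp

end IntegralOperator

/-- The `j`-th eigenvalue, `j = 0, 1, 2, …`, of a compact positive self-adjoint operator, in
non-increasing order and counted with multiplicity: the largest `t > 0` such that the eigenspaces
for the eigenvalues `≥ t` have total dimension at least `j + 1`, and `0` if there is no such `t`. -/
def sortedEigenvalue {H : Type*} [NormedAddCommGroup H] [InnerProductSpace ℝ H]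
    (T : H →L[ℝ] H) (j : ℕ) : ℝ :=
  sSup {t : ℝ | 0 < t ∧ ((j + 1 : ℕ) : Cardinal) ≤
    Module.rank ℝ ↥(⨆ ν ∈ Set.Ici t, Module.End.eigenspace (T : H →ₗ[ℝ] H) ν)}

section Kernels

/-- The input distribution `N(0, I_d)`. -/
abbrev inputMeasure (d : ℕ) : Measure (EuclideanSpace ℝ (Fin d)) :=
  stdGaussian (EuclideanSpace ℝ (Fin d))

/-- The conjugate kernel `k(x, x') = E[σ(⟨w, x⟩) σ(⟨w, x'⟩)]`, `w ∼ N(0, S)`. -/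
def conjKernel {d : ℕ} (σ : ℝ → ℝ) (S : Matrix (Fin d) (Fin d) ℝ)
    (x x' : EuclideanSpace ℝ (Fin d)) : ℝ :=
  ∫ w, σ ⟪w, x⟫ * σ ⟪w, x'⟫ ∂(multivariateGaussian 0 S)

/-- The kernel `k` truncated to the ball of radius `R` in both variables. -/
def truncKernel {d : ℕ} (R : ℝ)
    (k : EuclideanSpace ℝ (Fin d) → EuclideanSpace ℝ (Fin d) → ℝ)
    (x x' : EuclideanSpace ℝ (Fin d)) : ℝ :=
  (Metric.ball 0 R ×ˢ Metric.ball 0 R).indicator (Function.uncurry k) (x, x')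

theorem lipschitz_growth {d : ℕ} {L : ℝ≥0} {σ : ℝ → ℝ} (hσ : LipschitzWith L σ)
    (w x : EuclideanSpace ℝ (Fin d)) :
    |σ ⟪w, x⟫| ≤ (|σ 0| + L * ‖w‖) * (1 + ‖x‖) := by
  have h1 : |σ ⟪w, x⟫ - σ 0| ≤ L * |⟪w, x⟫| := by
    simpa [Real.dist_eq] using hσ.dist_le_mul ⟪w, x⟫ 0
  have h2 : |σ ⟪w, x⟫| ≤ |σ ⟪w, x⟫ - σ 0| + |σ 0| := by
    simpa using abs_add_le (σ ⟪w, x⟫ - σ 0) (σ 0)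
  have h3 : |⟪w, x⟫| ≤ ‖w‖ * ‖x‖ := abs_real_inner_le_norm w x
  have h4 : (L : ℝ) * |⟪w, x⟫| ≤ L * (‖w‖ * ‖x‖) := by gcongr
  have h5 : 0 ≤ |σ 0| * ‖x‖ := by positivity
  have h6 : 0 ≤ (L : ℝ) * ‖w‖ := by positivity
  nlinarith

theorem conjKernel_measurable {d : ℕ} {σ : ℝ → ℝ} (hσ : Continuous σ)
    (S : Matrix (Fin d) (Fin d) ℝ) : StronglyMeasurable (Function.uncurry (conjKernel σ S)) := by
  have h : StronglyMeasurable (fun p : (EuclideanSpace ℝ (Fin d) × EuclideanSpace ℝ (Fin d)) ×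
      EuclideanSpace ℝ (Fin d) => σ ⟪p.2, p.1.1⟫ * σ ⟪p.2, p.1.2⟫) :=
    Continuous.stronglyMeasurable (by fun_prop)
  exact h.integral_prod_right' (ν := multivariateGaussian 0 S)

theorem gaussian_norm_memLp {d : ℕ} (γ : Measure (EuclideanSpace ℝ (Fin d))) [IsGaussian γ]
    (a b : ℝ) : MemLp (fun w : EuclideanSpace ℝ (Fin d) => a + b * ‖w‖) 2 γ := by
  have h : MemLp (fun w : EuclideanSpace ℝ (Fin d) => ‖w‖) 2 γ :=
    (IsGaussian.memLp_two_id (μ := γ)).norm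
  have h2 : MemLp (fun _ : EuclideanSpace ℝ (Fin d) => a) 2 γ := memLp_const a
  exact h2.add (h.const_mul b)

theorem conjKernel_bound {d : ℕ} {L : ℝ≥0} {σ : ℝ → ℝ} (hσ : LipschitzWith L σ)
    (S : Matrix (Fin d) (Fin d) ℝ) (x x' : EuclideanSpace ℝ (Fin d)) :
    ‖conjKernel σ S x x'‖ ≤
      (∫ w, (|σ 0| + L * ‖w‖) ^ 2 ∂(multivariateGaussian (0 : EuclideanSpace ℝ (Fin d)) S)) *
        ((1 + ‖x‖) * (1 + ‖x'‖)) := by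
  have hid : MemLp (fun w : EuclideanSpace ℝ (Fin d) => |σ 0| + L * ‖w‖) 2
      (multivariateGaussian 0 S) := gaussian_norm_memLp _ _ _
  unfold conjKernel
  rw [← integral_mul_const]
  refine norm_integral_le_of_norm_le (hid.integrable_sq.mul_const _) (ae_of_all _ fun w => ?_)
  rw [norm_mul, Real.norm_eq_abs, Real.norm_eq_abs]
  calc |σ ⟪w, x⟫| * |σ ⟪w, x'⟫|
      ≤ ((|σ 0| + L * ‖w‖) * (1 + ‖x‖)) * ((|σ 0| + L * ‖w‖) * (1 + ‖x'‖)) :=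
        mul_le_mul (lipschitz_growth hσ w x) (lipschitz_growth hσ w x') (abs_nonneg _)
          (by positivity)
    _ = _ := by ring

theorem conjKernel_memLp {d : ℕ} {L : ℝ≥0} {σ : ℝ → ℝ} (hσ : LipschitzWith L σ)
    (S : Matrix (Fin d) (Fin d) ℝ) :
    MemLp (Function.uncurry (conjKernel σ S)) 2 ((inputMeasure d).prod (inputMeasure d)) := by
  have hx : MemLp (fun x : EuclideanSpace ℝ (Fin d) => 1 + ‖x‖) 2 (inputMeasure d) := by
    simpa using gaussian_norm_memLp (inputMeasure d) 1 1
  have hprod : MemLp (fun p : EuclideanSpace ℝ (Fin d) × EuclideanSpace ℝ (Fin d) =>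
      (1 + ‖p.1‖) * (1 + ‖p.2‖)) 2 ((inputMeasure d).prod (inputMeasure d)) := by
    refine (memLp_two_iff_integrable_sq ?_).2 ?_
    · exact Continuous.aestronglyMeasurable (by fun_prop)
    · simpa only [mul_pow] using hx.integrable_sq.mul_prod hx.integrable_sq
  exact (hprod.const_mul _).mono' (conjKernel_measurable hσ.continuous S).aestronglyMeasurable
    (ae_of_all _ fun p => conjKernel_bound hσ S p.1 p.2)

theorem truncKernel_memLp {d : ℕ} {k : EuclideanSpace ℝ (Fin d) → EuclideanSpace ℝ (Fin d) → ℝ}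
    (R : ℝ) (hk : MemLp (Function.uncurry k) 2 ((inputMeasure d).prod (inputMeasure d))) :
    MemLp (Function.uncurry (truncKernel R k)) 2 ((inputMeasure d).prod (inputMeasure d)) :=
  hk.indicator (Metric.isOpen_ball.measurableSet.prod Metric.isOpen_ball.measurableSet)

/-- The integral operator on `L²(N(0, I_d))` of the conjugate kernel with weights `N(0, S)`. -/
def conjOp {d : ℕ} {L : ℝ≥0} {σ : ℝ → ℝ} (hσ : LipschitzWith L σ)
    (S : Matrix (Fin d) (Fin d) ℝ) :
    Lp ℝ 2 (inputMeasure d) →L[ℝ] Lp ℝ 2 (inputMeasure d) :=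
  integralOp (conjKernel σ S) (conjKernel_memLp hσ S)

/-- The same integral operator, with the kernel truncated to the ball of radius `R`. -/
def truncConjOp {d : ℕ} {L : ℝ≥0} {σ : ℝ → ℝ} (hσ : LipschitzWith L σ)
    (S : Matrix (Fin d) (Fin d) ℝ) (R : ℝ) :
    Lp ℝ 2 (inputMeasure d) →L[ℝ] Lp ℝ 2 (inputMeasure d) :=
  integralOp (truncKernel R (conjKernel σ S)) (truncKernel_memLp R (conjKernel_memLp hσ S))

end Kernels

section SpikedCovariance

/-- `μ₁ = E[g'(z)]`, `z ∼ N(0, 1)`; for Lipschitz `g` the derivative exists almost everywhere. -/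
def hermiteOne (g : ℝ → ℝ) : ℝ := ∫ z, deriv g z ∂(gaussianReal 0 1)

/-- `s = E[h''(z)] / 2` for `h = g²`, `z ∼ N(0, 1)`. The second derivative is the distributional
one, so that `E[h''(z)] = E[(z² - 1) h(z)]`. -/
def spikeCoef (g : ℝ → ℝ) : ℝ := (1 / 2) * ∫ z, (z ^ 2 - 1) * g z ^ 2 ∂(gaussianReal 0 1)

/-- The isotropic coefficient `A` of the covariance; `v` is the noise variance, `η` the step size,
`α = n / d` and `β = m / d`. -/
def covA (g : ℝ → ℝ) (v α β η : ℝ) (d : ℕ) : ℝ :=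
  1 + η ^ 2 * (hermiteOne g ^ 2 / (α * β ^ 2)) / (d : ℝ) ^ 2 * ∫ z, g z ^ 2 ∂(gaussianReal 0 1)
    + η ^ 2 * (hermiteOne g ^ 2 / (α * β ^ 2)) / (d : ℝ) ^ 2 * v

/-- The spike coefficient `B` of the covariance. -/
def covB (g : ℝ → ℝ) (α β η : ℝ) (d : ℕ) : ℝ :=
  η ^ 2 / (d : ℝ) * (hermiteOne g ^ 4 / (α * β ^ 2)) *
    (α - 1 / (d : ℝ) + 2 * spikeCoef g / (hermiteOne g ^ 2 * (d : ℝ)))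

/-- `Γ = A I_d + B w wᵀ`. -/
def spikedCov (g : ℝ → ℝ) (v α β η : ℝ) {d : ℕ} (w : EuclideanSpace ℝ (Fin d)) :
    Matrix (Fin d) (Fin d) ℝ :=
  covA g v α β η d • (1 : Matrix (Fin d) (Fin d) ℝ)
    + covB g α β η d • Matrix.vecMulVec w.ofLp w.ofLp

end SpikedCovariance

/-- `T₀`: the operator of the isotropic kernel, with weights `N(0, I_d / d)`. -/
def isotropicOp (d : ℕ) {L : ℝ≥0} {σ : ℝ → ℝ} (hσ : LipschitzWith L σ) :
    Lp ℝ 2 (inputMeasure d) →L[ℝ] Lp ℝ 2 (inputMeasure d) :=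
  conjOp hσ ((1 / (d : ℝ)) • (1 : Matrix (Fin d) (Fin d) ℝ))

/-- `T₁`: the operator of the spiked kernel, with weights `N(0, Γ / d)`. -/
def spikedOp {d : ℕ} {L : ℝ≥0} {σ : ℝ → ℝ} (hσ : LipschitzWith L σ)
    (Γ : Matrix (Fin d) (Fin d) ℝ) :
    Lp ℝ 2 (inputMeasure d) →L[ℝ] Lp ℝ 2 (inputMeasure d) :=
  conjOp hσ ((1 / (d : ℝ)) • Γ)

/-- `T₀` truncated to the ball of radius `R`. -/
def isotropicOpTrunc (d : ℕ) {L : ℝ≥0} {σ : ℝ → ℝ} (hσ : LipschitzWith L σ) (R : ℝ) :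
    Lp ℝ 2 (inputMeasure d) →L[ℝ] Lp ℝ 2 (inputMeasure d) :=
  truncConjOp hσ ((1 / (d : ℝ)) • (1 : Matrix (Fin d) (Fin d) ℝ)) R

/-- `T₁` truncated to the ball of radius `R`. -/
def spikedOpTrunc {d : ℕ} {L : ℝ≥0} {σ : ℝ → ℝ} (hσ : LipschitzWith L σ)
    (Γ : Matrix (Fin d) (Fin d) ℝ) (R : ℝ) :
    Lp ℝ 2 (inputMeasure d) →L[ℝ] Lp ℝ 2 (inputMeasure d) :=
  truncConjOp hσ ((1 / (d : ℝ)) • Γ) R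

end

/-! Write `u_w(x) = σ(⟨w, x⟩)`. Each `T_i` is the average of the rank-one operators `u_w ⊗ u_w` over
the Gaussian weight law `ν_i`, so `⟨f, T_i f⟩ = ∫ ⟨u_w, f⟩² dν_i(w)` (`conjOp_eq_mixtureOp`,
`inner_self_mixtureOp`). Any domination between `ν₀` and `ν₁` therefore passes to the quadratic
forms and, by min-max, to all eigenvalues at once, with a constant that sees neither `σ` nor the
index.

Since `A ≥ 1` and, for large `d`, `B ≥ 0`, the covariance satisfies `Γ ≥ I`. The density of `ν₁` is
then everywhere at least `det Γ ^ (-1/2)` times that of `ν₀` (`smul_isotropic_le_spiked`); this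
yields `c_d`. The reverse ratio need not be bounded, but on the ball of radius `r` it is at most
`exp(d r² / 2)` (`spiked_restrict_le_smul_isotropic`), and Gaussian exponential moments control the
weights outside. Hence `λ_j(T₁) ≤ exp(d r² / 2) λ_j(T₀) + K exp(-κ r²)` for every `r ≥ 0`
(`exists_sortedEigenvalue_spikedOp_le`).

A fixed `r = R / √d` gives the upper bound of part 1. For part 2, `r` varies with `j`: taking `d r²
= -log λ_j(T₀)` turns the right side into at most `(1 + K) λ_j(T₀)^p` with some `p > 0`, once
`λ_j(T₀) < 1`, and the lower bound supplies the other half of the logarithmic equivalence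
(`isTheta_log_of_comparison`). Truncating the inputs is a separate perturbation: it moves `u_w`
little in `L²`, hence moves the form, and every eigenvalue, little. -/

noncomputable section

/-! ### Min-max principle for compact positive operators -/

section MinMax

variable {H : Type*} [NormedAddCommGroup H] [InnerProductSpace ℝ H]

/-- The sum of the eigenspaces of `T` for the eigenvalues `≥ t`. -/
abbrev upperEigenspace (T : H →L[ℝ] H) (t : ℝ) : Submodule ℝ H :=
  ⨆ ν ∈ Set.Ici t, Module.End.eigenspace (T : H →ₗ[ℝ] H) ν

/-- The levels `t > 0` such that the quadratic form of `T` dominates `t ‖·‖²` on some subspace of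
dimension `n`. -/
def formLevels (T : H →L[ℝ] H) (n : ℕ) : Set ℝ :=
  {t : ℝ | 0 < t ∧ ∃ F : Submodule ℝ H, Module.finrank ℝ F = n ∧ ∀ f ∈ F, t * ‖f‖ ^ 2 ≤ ⟪f, T f⟫}

/-- Eigenspaces of a symmetric operator are mutually orthogonal, so both sides are computed by
Pythagoras on a finite sum of eigenvectors. -/
theorem le_inner_of_mem_upperEigenspace {T : H →L[ℝ] H} (hT : T.IsPositive) {t : ℝ} {f : H}
    (hf : f ∈ upperEigenspace T t) : t * ‖f‖ ^ 2 ≤ ⟪f, T f⟫ := by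
  classical
  rw [upperEigenspace, iSup_subtype', Submodule.mem_iSup_iff_exists_finsupp] at hf
  obtain ⟨x, hx, rfl⟩ := hf
  have horth := hT.1.orthogonalFamily_eigenspaces.comp
    (Subtype.val_injective (p := fun ν => ν ∈ Set.Ici t))
  let l : (ν : Set.Ici t) → Module.End.eigenspace (T : H →ₗ[ℝ] H) ν := fun ν => ⟨x ν, hx ν⟩
  let l' : (ν : Set.Ici t) → Module.End.eigenspace (T : H →ₗ[ℝ] H) ν := fun ν => (ν : ℝ) • l ν
  have hn := horth.norm_sum l x.support
  have hi := horth.inner_sum l l' x.support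
  have hT' : T (x.sum fun _ y => y) = ∑ ν ∈ x.support, (ν : ℝ) • x ν := by
    rw [Finsupp.sum, map_sum]
    exact Finset.sum_congr rfl fun ν _ => Module.End.mem_eigenspace_iff.1 (hx ν)
  have hi' : ⟪x.sum fun _ y => y, T (x.sum fun _ y => y)⟫
      = ∑ ν ∈ x.support, (ν : ℝ) * ‖x ν‖ ^ 2 := by
    rw [hT']
    refine hi.trans (Finset.sum_congr rfl fun ν _ => ?_)
    simp [l, l', real_inner_smul_right]
  have hn' : ‖x.sum fun _ y => y‖ ^ 2 = ∑ ν ∈ x.support, ‖x ν‖ ^ 2 := hn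
  rw [hi', hn', Finset.mul_sum]
  refine Finset.sum_le_sum fun ν _ => ?_
  have : t ≤ ν := ν.2
  gcongr

theorem apply_mem_upperEigenspace {T : H →L[ℝ] H} {t : ℝ} {f : H}
    (hf : f ∈ upperEigenspace T t) : T f ∈ upperEigenspace T t := by
  rw [upperEigenspace, iSup_subtype'] at hf ⊢
  refine Submodule.iSup_induction _ (motive := fun x => T x ∈ _) hf (fun ν x hx => ?_) (by simp)
    fun x y hx hy => by rw [map_add]; exact add_mem hx hy
  refine Submodule.mem_iSup_of_mem ν ?_
  rw [show T x = (ν : ℝ) • x from Module.End.mem_eigenspace_iff.1 hx]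
  exact Submodule.smul_mem _ _ hx

/-- The orthogonal complement is invariant, and the restriction of `T` to it is compact and
self-adjoint, so its norm is its spectral radius. Its nonzero spectrum consists of eigenvalues of
`T`; positivity makes these nonnegative, and one exceeding `t` would have its eigenvector in the
upper eigenspace and in its complement. -/
theorem inner_le_of_mem_orthogonal_upperEigenspace [CompleteSpace H] {T : H →L[ℝ] H}
    (hT : T.IsPositive) (hc : IsCompactOperator T) {t : ℝ} (ht : 0 < t) {f : H}
    (hf : f ∈ (upperEigenspace T t)ᗮ) : ⟪f, T f⟫ ≤ t * ‖f‖ ^ 2 := by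
  have hinv : ∀ v ∈ (upperEigenspace T t)ᗮ, T v ∈ (upperEigenspace T t)ᗮ := by
    intro v hv
    rw [Submodule.mem_orthogonal] at hv ⊢
    intro w hw
    have := hv _ (apply_mem_upperEigenspace hw)
    rwa [show ⟪T w, v⟫ = ⟪w, T v⟫ from hT.1 w v] at this
  let S : (upperEigenspace T t)ᗮ →L[ℝ] (upperEigenspace T t)ᗮ := T.restrict hinv
  have hSc : IsCompactOperator S := hc.restrict' (f := (T : H →ₗ[ℝ] H)) hinv
  have hSs : S.IsSymmetric := hT.1.restrict_invariant hinv
  have hS : ‖S‖ ≤ t := by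
    have h1 : spectralRadius ℝ S ≤ ENNReal.ofReal t := by
      refine iSup₂_le fun μ hμ => ?_
      rw [← enorm_eq_nnnorm, ← ofReal_norm, Real.norm_eq_abs]
      refine ENNReal.ofReal_le_ofReal ?_
      rcases eq_or_ne μ 0 with rfl | h0
      · simpa using ht.le
      obtain ⟨v, hv, hv0⟩ := ((hSc.hasEigenvalue_iff_mem_spectrum h0).2 hμ).exists_hasEigenvector
      have hTv : T v = μ • (v : H) := congrArg Subtype.val (Module.End.mem_eigenspace_iff.1 hv)
      have hv0' : (v : H) ≠ 0 := fun h => hv0 (Subtype.ext h)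
      have hn : 0 < ‖(v : H)‖ ^ 2 := by positivity
      have hμ0 : 0 ≤ μ := by
        have := hT.inner_nonneg_right (v : H)
        rw [hTv, real_inner_smul_right, real_inner_self_eq_norm_sq] at this
        exact nonneg_of_mul_nonneg_left this hn
      rw [abs_of_nonneg hμ0]
      by_contra! hlt
      have hmem : (v : H) ∈ upperEigenspace T t :=
        Submodule.mem_iSup_of_mem μ (Submodule.mem_iSup_of_mem hlt.le
          (Module.End.mem_eigenspace_iff.2 hTv))
      have := (Submodule.mem_orthogonal _ _).1 v.2 _ hmem
      exact hv0' (inner_self_eq_zero.1 this)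
    rw [S.spectralRadius_eq_nnnorm hSs.isSelfAdjoint] at h1
    have h2 := ENNReal.toReal_mono ENNReal.ofReal_ne_top h1
    rwa [ENNReal.toReal_ofReal ht.le] at h2
  calc ⟪f, T f⟫ ≤ ‖f‖ * ‖T f‖ := real_inner_le_norm _ _
    _ = ‖f‖ * ‖S ⟨f, hf⟩‖ := rfl
    _ ≤ ‖f‖ * (t * ‖f‖) := by
      gcongr
      exact (S.le_opNorm ⟨f, hf⟩).trans (by gcongr; rfl)
    _ = t * ‖f‖ ^ 2 := by ring

theorem exists_ne_zero_of_finrank_pos {F : Submodule ℝ H} {n : ℕ}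
    (hF : Module.finrank ℝ F = n + 1) : ∃ f ∈ F, f ≠ 0 := by
  have : Nontrivial F := Module.nontrivial_of_finrank_pos (R := ℝ) (by omega)
  obtain ⟨f, hf⟩ := exists_ne (0 : F)
  exact ⟨f, f.2, fun h => hf (Subtype.ext h)⟩

theorem formLevels_bddAbove (T : H →L[ℝ] H) (j : ℕ) : BddAbove (formLevels T (j + 1)) := by
  refine ⟨‖T‖, ?_⟩
  rintro t ⟨-, F, hF, h⟩
  obtain ⟨f, hf, hf0⟩ := exists_ne_zero_of_finrank_pos hF
  have hn : 0 < ‖f‖ ^ 2 := by positivity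
  refine le_of_mul_le_mul_right ((h f hf).trans ?_) hn
  calc ⟪f, T f⟫ ≤ ‖f‖ * ‖T f‖ := real_inner_le_norm _ _
    _ ≤ ‖f‖ * (‖T‖ * ‖f‖) := by gcongr; exact T.le_opNorm f
    _ = ‖T‖ * ‖f‖ ^ 2 := by ring

/-- The min-max principle: `sortedEigenvalue T j` is the supremum of the levels dominated by the
quadratic form of `T` on some subspace of dimension `j + 1`. -/
theorem sortedEigenvalue_eq_sSup_formLevels [CompleteSpace H] {T : H →L[ℝ] H}
    (hT : T.IsPositive) (hc : IsCompactOperator T) (j : ℕ) :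
    sortedEigenvalue T j = sSup (formLevels T (j + 1)) := by
  have hsub : {t : ℝ | 0 < t ∧ ((j + 1 : ℕ) : Cardinal) ≤ Module.rank ℝ ↥(upperEigenspace T t)}
      ⊆ formLevels T (j + 1) := by
    rintro t ⟨ht, hr⟩
    refine ⟨ht, ?_⟩
    obtain ⟨s, hs, hli⟩ := le_rank_iff_exists_linearIndependent_finset.1 hr
    refine ⟨(Submodule.span ℝ (s : Set (upperEigenspace T t))).map
      (upperEigenspace T t).subtype, ?_, ?_⟩
    · rw [Submodule.finrank_map_subtype_eq, finrank_span_finset_eq_card hli, hs]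
    · rintro _ ⟨f, -, rfl⟩
      exact le_inner_of_mem_upperEigenspace hT f.2
  have hb := formLevels_bddAbove T j
  have h0 : 0 ≤ sSup {t : ℝ | 0 < t ∧
      ((j + 1 : ℕ) : Cardinal) ≤ Module.rank ℝ ↥(upperEigenspace T t)} :=
    Real.sSup_nonneg fun t ht => ht.1.le
  refine le_antisymm ?_ ?_
  · exact Real.sSup_le (fun t ht => le_csSup hb (hsub ht)) (Real.sSup_nonneg fun t ht => ht.1.le)
  · refine Real.sSup_le ?_ h0
    rintro t ⟨ht, F, hF, h⟩
    -- Passing to a slightly smaller level `t'` leaves room for a strict contradiction between the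
    -- two form bounds below.
    refine le_of_forall_lt_imp_le_of_dense fun t' ht' => ?_
    rcases le_or_gt t' 0 with hn | hpos
    · exact hn.trans h0
    refine le_csSup (hb.mono hsub) ⟨hpos, ?_⟩
    by_contra! hlt
    have hfin : FiniteDimensional ℝ (upperEigenspace T t') :=
      Module.rank_lt_aleph0_iff.1 (hlt.trans (Cardinal.natCast_lt_aleph0))
    have hlt' : Module.finrank ℝ (upperEigenspace T t') < Module.finrank ℝ F := by
      rw [← Module.finrank_eq_rank] at hlt
      rw [hF]
      exact_mod_cast hlt
    -- `F` has larger dimension than the upper eigenspace, so the projection of `F` onto it has a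
    -- kernel. A nonzero vector there has form at least `t ‖f‖²` and at most `t' ‖f‖²`.
    have hFfin : FiniteDimensional ℝ F := Module.finite_of_finrank_pos (by omega)
    obtain ⟨f, hf, hf0⟩ := Submodule.exists_mem_ne_zero_of_ne_bot
      (LinearMap.ker_ne_bot_of_finrank_lt
        (f := (upperEigenspace T t').orthogonalProjectionOnto.toLinearMap ∘ₗ F.subtype) hlt')
    have hf' : (f : H) ∈ (upperEigenspace T t')ᗮ :=
      (Submodule.orthogonalProjectionOnto_eq_zero_iff).1 (by simpa using hf)
    have hfn : 0 < ‖(f : H)‖ ^ 2 := by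
      have : (f : H) ≠ 0 := fun h => hf0 (Subtype.ext h)
      positivity
    have := (h f f.2).trans (inner_le_of_mem_orthogonal_upperEigenspace hT hc hpos hf')
    exact absurd (le_of_mul_le_mul_right this hfn) (not_le.2 ht')

theorem sortedEigenvalue_nonneg (T : H →L[ℝ] H) (j : ℕ) : 0 ≤ sortedEigenvalue T j :=
  Real.sSup_nonneg fun _ ht => ht.1.le

/-- A subspace on which `T₁` has level `t` is one on which `T₀` has level `(t - ε) / C`. This is the
only route from forms to eigenvalues in the comparison. -/
theorem sortedEigenvalue_le_of_inner_le [CompleteSpace H] {T₀ T₁ : H →L[ℝ] H}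
    (hT₀ : T₀.IsPositive) (hc₀ : IsCompactOperator T₀)
    (hT₁ : T₁.IsPositive) (hc₁ : IsCompactOperator T₁) {C ε : ℝ} (hC : 0 < C) (hε : 0 ≤ ε)
    (h : ∀ f, ⟪f, T₁ f⟫ ≤ C * ⟪f, T₀ f⟫ + ε * ‖f‖ ^ 2) (j : ℕ) :
    sortedEigenvalue T₁ j ≤ C * sortedEigenvalue T₀ j + ε := by
  have h0 := sortedEigenvalue_nonneg T₀ j
  rw [sortedEigenvalue_eq_sSup_formLevels hT₁ hc₁]
  refine Real.sSup_le ?_ (by positivity)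
  rintro t ⟨ht, F, hF, hFt⟩
  -- Levels must be positive; for `t ≤ ε` the bound follows from nonnegativity of the eigenvalue of
  -- `T₀`.
  rcases le_or_gt t ε with hle | hlt
  · nlinarith
  have hmem : (t - ε) / C ∈ formLevels T₀ (j + 1) := by
    refine ⟨div_pos (sub_pos.2 hlt) hC, F, hF, fun f hf => ?_⟩
    rw [div_mul_eq_mul_div, div_le_iff₀ hC]
    linarith [h f, hFt f hf]
  have := le_csSup (formLevels_bddAbove T₀ j) hmem
  rw [← sortedEigenvalue_eq_sSup_formLevels hT₀ hc₀, div_le_iff₀ hC] at this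
  linarith

theorem abs_sortedEigenvalue_sub_le [CompleteSpace H] {T₀ T₁ : H →L[ℝ] H}
    (hT₀ : T₀.IsPositive) (hc₀ : IsCompactOperator T₀)
    (hT₁ : T₁.IsPositive) (hc₁ : IsCompactOperator T₁) {ε : ℝ} (hε : 0 ≤ ε)
    (h : ∀ f, |⟪f, T₀ f⟫ - ⟪f, T₁ f⟫| ≤ ε * ‖f‖ ^ 2) (j : ℕ) :
    |sortedEigenvalue T₀ j - sortedEigenvalue T₁ j| ≤ ε := by
  have h1 := sortedEigenvalue_le_of_inner_le hT₀ hc₀ hT₁ hc₁ one_pos hε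
    (fun f => by linarith [neg_le_abs (⟪f, T₀ f⟫ - ⟪f, T₁ f⟫), h f]) j
  have h2 := sortedEigenvalue_le_of_inner_le hT₁ hc₁ hT₀ hc₀ one_pos hε
    (fun f => by linarith [le_abs_self (⟪f, T₀ f⟫ - ⟪f, T₁ f⟫), h f]) j
  rw [abs_le]
  constructor <;> linarith

end MinMax

/-! ### Averages of rank-one operators -/

section MixtureOperator

variable {H : Type*} [NormedAddCommGroup H] [InnerProductSpace ℝ H]
  {W : Type*} [MeasurableSpace W]

/-- The operator `f ↦ ∫ ⟪u w, f⟫ u w dν(w)`. -/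
def mixtureOp (ν : Measure W) (u : W → H) : H →L[ℝ] H :=
  ∫ w, InnerProductSpace.rankOne ℝ (u w) (u w) ∂ν

variable {ν : Measure W} {u : W → H}

theorem integrable_rankOne (hu : MemLp u 2 ν) :
    Integrable (fun w => InnerProductSpace.rankOne ℝ (u w) (u w)) ν := by
  refine (hu.norm.integrable_sq).mono' ?_ (ae_of_all _ fun w => by simp [sq])
  have hc : Continuous fun x : H => InnerProductSpace.rankOne ℝ x x :=
    (InnerProductSpace.rankOne ℝ (E := H) (F := H)).continuous₂.comp (continuous_id.prodMk continuous_id)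
  exact hc.comp_aestronglyMeasurable hu.1

theorem memLp_inner (hu : MemLp u 2 ν) (f : H) : MemLp (fun w => ⟪u w, f⟫) 2 ν :=
  (hu.norm.mul_const ‖f‖).mono' (hu.1.inner aestronglyMeasurable_const)
    (ae_of_all _ fun _ => norm_inner_le_norm _ _)

variable [CompleteSpace H]

theorem inner_mixtureOp (hu : MemLp u 2 ν) (f g : H) :
    ⟪f, mixtureOp ν u g⟫ = ∫ w, ⟪u w, f⟫ * ⟪u w, g⟫ ∂ν := by
  rw [mixtureOp, ContinuousLinearMap.integral_apply (integrable_rankOne hu), ← integral_inner]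
  · simp [real_inner_smul_right, real_inner_comm, mul_comm]
  · exact (integrable_rankOne hu).apply_continuousLinearMap g

theorem inner_self_mixtureOp (hu : MemLp u 2 ν) (f : H) :
    ⟪f, mixtureOp ν u f⟫ = ∫ w, ⟪u w, f⟫ ^ 2 ∂ν := by
  simp_rw [inner_mixtureOp hu, sq]

theorem mixtureOp_isPositive (hu : MemLp u 2 ν) : (mixtureOp ν u).IsPositive := by
  refine ⟨fun f g => ?_, fun f => ?_⟩
  · change ⟪mixtureOp ν u f, g⟫ = ⟪f, mixtureOp ν u g⟫
    rw [real_inner_comm, inner_mixtureOp hu, inner_mixtureOp hu]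
    simp_rw [mul_comm]
  · rw [ContinuousLinearMap.reApplyInnerSelf_apply, real_inner_comm, inner_self_mixtureOp hu]
    exact integral_nonneg fun _ => sq_nonneg _

/-- Compact operators form a closed convex set in operator norm, so the mean of rank-one operators
under a probability measure stays in it. -/
theorem mixtureOp_isCompactOperator [IsProbabilityMeasure ν] (hu : MemLp u 2 ν) :
    IsCompactOperator (mixtureOp ν u) := by
  have hcl : IsClosed {T : H →L[ℝ] H | IsCompactOperator T} := isClosed_setOfPred_isCompactOperator
  have hconv : Convex ℝ {T : H →L[ℝ] H | IsCompactOperator T} :=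
    (compactOperator (RingHom.id ℝ) H H).convex
  refine hconv.integral_mem hcl (ae_of_all _ fun w => ?_) (integrable_rankOne hu)
  have h : IsCompactOperator (innerSL ℝ (u w)) :=
    isCompactOperator_of_locallyCompactSpace_dom (innerSL ℝ (u w))
  exact h.clm_comp (ContinuousLinearMap.toSpanSingleton ℝ (u w))

/-- A trace bound: summing the form over an orthonormal basis of a `(j + 1)`-dimensional subspace
and applying Bessel under the integral gives at most `∫ ‖u w‖²`. It serves to show that the
eigenvalues tend to `0`. -/
theorem sortedEigenvalue_mixtureOp_le [IsProbabilityMeasure ν] (hu : MemLp u 2 ν) (j : ℕ) :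
    sortedEigenvalue (mixtureOp ν u) j ≤ (∫ w, ‖u w‖ ^ 2 ∂ν) / (j + 1) := by
  have hj : (0 : ℝ) < j + 1 := by positivity
  have hn : 0 ≤ ∫ w, ‖u w‖ ^ 2 ∂ν := integral_nonneg fun _ => sq_nonneg _
  rw [sortedEigenvalue_eq_sSup_formLevels (mixtureOp_isPositive hu) (mixtureOp_isCompactOperator hu)]
  refine Real.sSup_le ?_ (by positivity)
  rintro t ⟨ht, F, hF, hFt⟩
  rw [le_div_iff₀ hj]
  have hFfin : FiniteDimensional ℝ F := Module.finite_of_finrank_pos (by omega)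
  let b := stdOrthonormalBasis ℝ F
  have hb : Orthonormal ℝ fun i => (b i : H) := b.orthonormal.comp_linearIsometry F.subtypeₗᵢ
  calc t * (j + 1) = ∑ i, t * ‖(b i : H)‖ ^ 2 := by
        simp [hb.1, hF, mul_comm]
    _ ≤ ∑ i, ⟪(b i : H), mixtureOp ν u (b i)⟫ := Finset.sum_le_sum fun i _ => hFt _ (b i).2
    _ = ∫ w, ∑ i, ⟪u w, (b i : H)⟫ ^ 2 ∂ν := by
      rw [integral_finsetSum _ fun i _ => (memLp_inner hu _).integrable_sq]
      simp_rw [inner_self_mixtureOp hu]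
    _ ≤ ∫ w, ‖u w‖ ^ 2 ∂ν := by
      refine integral_mono (integrable_finsetSum _ fun i _ => (memLp_inner hu _).integrable_sq)
        hu.norm.integrable_sq fun w => ?_
      simpa [real_inner_comm] using hb.sum_inner_products_le (x := u w) (s := Finset.univ)

end MixtureOperator

/-! ### Densities of Gaussian images and their comparison -/

section GaussianDensity

/-- The normalizing constant of the standard Gaussian density on `E`. -/
def gaussianConst (E : Type*) [NormedAddCommGroup E] [InnerProductSpace ℝ E] : ℝ := ((2 * Real.pi) ^ ((Module.finrank ℝ E : ℝ) / 2))⁻¹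

theorem gaussianConst_pos (E : Type*) [NormedAddCommGroup E] [InnerProductSpace ℝ E] :
     0 < gaussianConst E := by
  have := Real.pi_pos
  unfold gaussianConst
  positivity

variable (E : Type*) [NormedAddCommGroup E] [InnerProductSpace ℝ E] [FiniteDimensional ℝ E]
  [MeasurableSpace E] [BorelSpace E]

/-- Both measures have characteristic function `exp(-‖t‖² / 2)`; for the right side this is the
Gaussian Fourier integral, which also fixes the constant. -/
theorem stdGaussian_eq_withDensity : stdGaussian E =
    volume.withDensity fun x => ENNReal.ofReal (gaussianConst E * Real.exp (-‖x‖ ^ 2 / 2)) := by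
  have hpi := Real.pi_pos
  have hint : Integrable (fun x : E => gaussianConst E * Real.exp (-‖x‖ ^ 2 / 2)) volume := by
    refine Integrable.const_mul ?_ _
    have h := (GaussianFourier.integrable_cexp_neg_mul_sq_norm_add (b := 1 / 2) (V := E)
      (by norm_num) 0 0).re
    refine h.congr (ae_of_all _ fun x => ?_)
    simp only [zero_mul, add_zero]
    rw [show (-(1 / 2 : ℂ) * (‖x‖ : ℂ) ^ 2) = ((-‖x‖ ^ 2 / 2 : ℝ) : ℂ) by push_cast; ring]
    exact Complex.exp_ofReal_re _
  have hfin := isFiniteMeasure_withDensity_ofReal hint.2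
  refine Measure.ext_of_charFun ?_
  ext t
  rw [charFun_stdGaussian, charFun_apply, integral_withDensity_eq_integral_toReal_smul
    (by fun_prop) (ae_of_all _ fun _ => ENNReal.ofReal_lt_top)]
  have h := GaussianFourier.integral_cexp_neg_mul_sq_norm_add (b := 1 / 2) (V := E)
    (by norm_num) Complex.I t
  have hc : ((gaussianConst E : ℝ) : ℂ) * ((Real.pi : ℂ) / (1 / 2)) ^
      ((Module.finrank ℝ E : ℂ) / 2) = 1 := by
    rw [show ((Real.pi : ℂ) / (1 / 2)) = ((2 * Real.pi : ℝ) : ℂ) by push_cast; ring,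
      show ((Module.finrank ℝ E : ℂ) / 2) = (((Module.finrank ℝ E : ℝ) / 2 : ℝ) : ℂ) by
        push_cast; ring, ← Complex.ofReal_cpow (by positivity), ← Complex.ofReal_mul, gaussianConst,
      inv_mul_cancel₀ (by positivity), Complex.ofReal_one]
  calc Complex.exp (-(‖t‖ : ℂ) ^ 2 / 2)
      = gaussianConst E * ∫ v : E, Complex.exp (-(1 / 2) * (‖v‖ : ℂ) ^ 2
          + Complex.I * (⟪t, v⟫ : ℂ)) := by
        rw [h, ← mul_assoc, hc, one_mul, Complex.I_sq]
        ring_nf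
    _ = _ := by
        rw [← integral_const_mul]
        refine integral_congr_ae (ae_of_all _ fun v => ?_)
        have hpos := gaussianConst_pos E
        simp only
        rw [ENNReal.toReal_ofReal (by positivity), Complex.exp_add, Complex.real_smul,
          Complex.ofReal_mul, Complex.ofReal_exp, real_inner_comm, mul_comm Complex.I]
        push_cast
        ring_nf

variable {E}

theorem map_stdGaussian_eq_withDensity (M : E ≃L[ℝ] E) : (stdGaussian E).map M =
    volume.withDensity fun x => ENNReal.ofReal |(LinearMap.det (M : E →ₗ[ℝ] E))⁻¹| *
      ENNReal.ofReal (gaussianConst E * Real.exp (-‖M.symm x‖ ^ 2 / 2)) := by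
  have hM : Measurable M := M.continuous.measurable
  have hmap := Measure.map_linearMap_addHaar_eq_smul_addHaar (volume : Measure E)
    (f := (M : E →ₗ[ℝ] E)) (LinearEquiv.isUnit_det' M.toLinearEquiv).ne_zero
  have hmeas : Measurable fun x : E => ENNReal.ofReal
      (gaussianConst E * Real.exp (-‖M.symm x‖ ^ 2 / 2)) := by fun_prop
  ext s hs
  rw [Measure.map_apply hM hs, stdGaussian_eq_withDensity, withDensity_apply _ (hM hs),
    withDensity_apply _ hs, lintegral_const_mul _ hmeas, ← smul_eq_mul, ← lintegral_smul_measure,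
    ← Measure.restrict_smul, ← hmap]
  erw [setLIntegral_map hs hmeas hM]
  simp

/-- The hypothesis orders the exponents pointwise, so the ratio of densities is at least the ratio
of the normalizations. -/
theorem smul_map_stdGaussian_le {M₀ M₁ : E ≃L[ℝ] E} (h : ∀ x, ‖M₁.symm x‖ ≤ ‖M₀.symm x‖) :
    ENNReal.ofReal (|LinearMap.det (M₀ : E →ₗ[ℝ] E)| / |LinearMap.det (M₁ : E →ₗ[ℝ] E)|) •
      (stdGaussian E).map M₀ ≤ (stdGaussian E).map M₁ := by
  have h0 : 0 < |LinearMap.det (M₀ : E →ₗ[ℝ] E)| :=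
    abs_pos.2 (LinearEquiv.isUnit_det' M₀.toLinearEquiv).ne_zero
  have hc := gaussianConst_pos E
  rw [map_stdGaussian_eq_withDensity, map_stdGaussian_eq_withDensity,
    ← withDensity_smul _ (by fun_prop)]
  refine withDensity_mono (ae_of_all _ fun x => ?_)
  simp only [Pi.smul_apply, smul_eq_mul]
  rw [← mul_assoc, ← ENNReal.ofReal_mul (by positivity), abs_inv, abs_inv,
    div_mul_eq_mul_div, mul_inv_cancel₀ h0.ne', one_div]
  gcongr
  exact h x

/-- The exponential in the density of the `M₁` image is at most `1` and its normalization is the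
smaller one; on `s` the exponential of the `M₀` image is at least `1 / C`. -/
theorem map_stdGaussian_restrict_le {M₀ M₁ : E ≃L[ℝ] E}
    (h : |LinearMap.det (M₀ : E →ₗ[ℝ] E)| ≤ |LinearMap.det (M₁ : E →ₗ[ℝ] E)|)
    {s : Set E} (hs : MeasurableSet s) {C : ℝ} (hC : ∀ x ∈ s, Real.exp (‖M₀.symm x‖ ^ 2 / 2) ≤ C) :
    ((stdGaussian E).map M₁).restrict s ≤ ENNReal.ofReal C • (stdGaussian E).map M₀ := by
  have h0 : 0 < |LinearMap.det (M₀ : E →ₗ[ℝ] E)| :=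
    abs_pos.2 (LinearEquiv.isUnit_det' M₀.toLinearEquiv).ne_zero
  have hc := gaussianConst_pos E
  rw [map_stdGaussian_eq_withDensity, map_stdGaussian_eq_withDensity,
    ← withDensity_smul _ (by fun_prop), restrict_withDensity hs]
  refine (withDensity_mono ?_).trans (by
    rw [← restrict_withDensity hs]
    exact Measure.restrict_le_self)
  refine (ae_restrict_iff' hs).2 (ae_of_all _ fun x hx => ?_)
  simp only [Pi.smul_apply, smul_eq_mul]
  have hCx := hC x hx
  have hCpos : 0 < C := (Real.exp_pos _).trans_le hCx
  rw [← ENNReal.ofReal_mul (by positivity), ← ENNReal.ofReal_mul (by positivity),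
    ← ENNReal.ofReal_mul (by positivity)]
  refine ENNReal.ofReal_le_ofReal ?_
  have h1 : Real.exp (-‖M₁.symm x‖ ^ 2 / 2) ≤ 1 := Real.exp_le_one_iff.2 (by
    have := sq_nonneg ‖M₁.symm x‖
    linarith)
  have h2 : 1 ≤ C * Real.exp (-‖M₀.symm x‖ ^ 2 / 2) := by
    calc (1 : ℝ) = Real.exp (‖M₀.symm x‖ ^ 2 / 2) * Real.exp (-‖M₀.symm x‖ ^ 2 / 2) := by
          rw [← Real.exp_add, neg_div, add_neg_cancel, Real.exp_zero]
      _ ≤ _ := by gcongr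
  rw [abs_inv, abs_inv]
  calc |LinearMap.det (M₁ : E →ₗ[ℝ] E)|⁻¹ * (gaussianConst E * Real.exp (-‖M₁.symm x‖ ^ 2 / 2))
      ≤ |LinearMap.det (M₀ : E →ₗ[ℝ] E)|⁻¹ *
          (gaussianConst E * (C * Real.exp (-‖M₀.symm x‖ ^ 2 / 2))) := by
        gcongr
        exact h1.trans h2
    _ = _ := by ring

end GaussianDensity

/-! ### Linear maps with one distinguished direction -/

section SpikeMap

variable {E : Type*} [NormedAddCommGroup E] [InnerProductSpace ℝ E]

/-- The linear map that is `q` on the line of the unit vector `v` and `p` on its orthogonal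
complement. -/
def spikeMap (v : E) (p q : ℝ) : E →ₗ[ℝ] E :=
  p • LinearMap.id + (q - p) • (innerₗ E v).smulRight v

theorem spikeMap_apply (v : E) (p q : ℝ) (x : E) :
    spikeMap v p q x = p • x + ((q - p) * ⟪v, x⟫) • v := by
  simp [spikeMap, smul_smul]

/-- For a unit `v` these maps are simultaneously diagonal, so they multiply eigenvalue by
eigenvalue. Inverses and square roots become explicit. -/
theorem spikeMap_spikeMap {v : E} (hv : ‖v‖ = 1) (p q p' q' : ℝ) (x : E) :
    spikeMap v p q (spikeMap v p' q' x) = spikeMap v (p * p') (q * q') x := by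
  have h1 : ⟪v, v⟫ = 1 := by rw [real_inner_self_eq_norm_sq, hv, one_pow]
  simp only [spikeMap_apply, inner_add_right, real_inner_smul_right, h1]
  module

theorem spikeMap_one (v : E) (x : E) : spikeMap v 1 1 x = x := by simp [spikeMap_apply]

theorem inner_spikeMap (v : E) (p q : ℝ) (x y : E) :
    ⟪spikeMap v p q x, y⟫ = ⟪x, spikeMap v p q y⟫ := by
  simp only [spikeMap_apply, inner_add_right, real_inner_smul_right, inner_add_left,
    real_inner_smul_left]
  rw [real_inner_comm v x]
  ring

theorem norm_spikeMap_sq {v : E} (hv : ‖v‖ = 1) (p q : ℝ) (x : E) :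
    ‖spikeMap v p q x‖ ^ 2 = p ^ 2 * ‖x‖ ^ 2 + (q ^ 2 - p ^ 2) * ⟪v, x⟫ ^ 2 := by
  rw [← real_inner_self_eq_norm_sq, inner_spikeMap, spikeMap_spikeMap hv, spikeMap_apply,
    inner_add_right, real_inner_smul_right, real_inner_smul_right, real_inner_self_eq_norm_sq,
    real_inner_comm v x]
  ring

theorem norm_spikeMap_le {v : E} (hv : ‖v‖ = 1) {p q r : ℝ} (hp : 0 ≤ p) (hq : 0 ≤ q)
    (hpr : p ≤ r) (hqr : q ≤ r) (x : E) : ‖spikeMap v p q x‖ ≤ r * ‖x‖ := by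
  have hr := hp.trans hpr
  refine le_of_sq_le_sq ?_ (by positivity)
  rw [norm_spikeMap_sq hv]
  have h1 : ⟪v, x⟫ ^ 2 ≤ ‖x‖ ^ 2 := by
    have := abs_real_inner_le_norm v x
    rw [hv, one_mul] at this
    rw [← sq_abs]
    gcongr
  have h2 : p ^ 2 ≤ r ^ 2 := by gcongr
  have h3 : q ^ 2 ≤ r ^ 2 := by gcongr
  nlinarith [mul_nonneg (sub_nonneg.2 h2) (sub_nonneg.2 h1),
    mul_nonneg (sub_nonneg.2 h3) (sq_nonneg ⟪v, x⟫)]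

/-- The map is `p` times a transvection of determinant `1 + (q - p) / p = q / p`. -/
theorem det_spikeMap [FiniteDimensional ℝ E] {v : E} (hv : ‖v‖ = 1) {p : ℝ} (hp : p ≠ 0) (q : ℝ) :
    LinearMap.det (spikeMap v p q) = p ^ Module.finrank ℝ E * (q / p) := by
  have h : spikeMap v p q
      = p • LinearMap.transvection (((q - p) / p) • innerₗ E v) v := by
    ext x
    rw [spikeMap_apply, LinearMap.smul_apply, LinearMap.transvection.apply, smul_add, smul_smul]
    simp only [LinearMap.smul_apply, innerₗ_apply_apply, smul_eq_mul]
    congr 2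
    field_simp
  rw [h, LinearMap.det_smul, LinearMap.transvection.det]
  simp only [LinearMap.smul_apply, innerₗ_apply_apply, real_inner_self_eq_norm_sq, hv, smul_eq_mul]
  congr 1
  field_simp
  ring

/-- `spikeMap v p q` as an invertible map. -/
def spikeEquiv [FiniteDimensional ℝ E] {v : E} (hv : ‖v‖ = 1) {p q : ℝ} (hp : p ≠ 0) (hq : q ≠ 0) :
    E ≃L[ℝ] E :=
  (LinearEquiv.ofLinearMap (spikeMap v p q) (spikeMap v p⁻¹ q⁻¹)
    (by ext x; simp [spikeMap_spikeMap hv, hp, hq, spikeMap_one])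
    (by ext x; simp [spikeMap_spikeMap hv, hp, hq, spikeMap_one])).toContinuousLinearEquiv

end SpikeMap

/-! ### Weight laws with spiked covariance -/

section SpikedGaussian

variable {d : ℕ} {v : EuclideanSpace ℝ (Fin d)} {a b : ℝ}

theorem spikedMatrix_posSemidef (ha : 0 ≤ a) (hb : 0 ≤ b) :
    ((1 / (d : ℝ)) • (a • (1 : Matrix (Fin d) (Fin d) ℝ)
      + b • Matrix.vecMulVec v.ofLp v.ofLp)).PosSemidef := by
  have h := Matrix.posSemidef_vecMulVec_self_star v.ofLp
  rw [star_trivial] at h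
  exact ((Matrix.PosSemidef.one.smul ha).add (h.smul hb)).smul (by positivity)

/-- The covariance has eigenvalue `(a + b) / d` along `v` and `a / d` across it, so this spike map
is its square root; the characteristic functions agree. -/
theorem multivariateGaussian_spiked (hv : ‖v‖ = 1) (ha : 0 ≤ a) (hb : 0 ≤ b) :
    multivariateGaussian 0 ((1 / (d : ℝ)) • (a • (1 : Matrix (Fin d) (Fin d) ℝ)
        + b • Matrix.vecMulVec v.ofLp v.ofLp)) =
      (stdGaussian (EuclideanSpace ℝ (Fin d))).map
        (spikeMap v (Real.sqrt (a / d)) (Real.sqrt ((a + b) / d))) := by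
  have hcont := (spikeMap v (Real.sqrt (a / d)) (Real.sqrt ((a + b) / d))).continuous_of_finiteDimensional
  have hprob := Measure.isProbabilityMeasure_map
    (μ := stdGaussian (EuclideanSpace ℝ (Fin d))) hcont.measurable.aemeasurable
  refine Measure.ext_of_charFun ?_
  ext t
  rw [charFun_multivariateGaussian (spikedMatrix_posSemidef ha hb), charFun_apply,
    integral_map hcont.measurable.aemeasurable (by fun_prop)]
  simp_rw [inner_spikeMap]
  rw [← charFun_apply, charFun_stdGaussian, ← Complex.ofReal_pow, norm_spikeMap_sq hv,
    Real.sq_sqrt (by positivity), Real.sq_sqrt (by positivity)]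
  have h1 : t.ofLp ⬝ᵥ t.ofLp = ‖t‖ ^ 2 := by
    rw [EuclideanSpace.real_norm_sq_eq]; simp [dotProduct, sq]
  have h2 : t.ofLp ⬝ᵥ v.ofLp = ⟪v, t⟫ := by
    simp [dotProduct, PiLp.inner_apply]
  have h3 : v.ofLp ⬝ᵥ t.ofLp = ⟪v, t⟫ := by rw [dotProduct_comm, h2]
  simp only [Matrix.smul_mulVec, Matrix.add_mulVec, Matrix.one_mulVec, dotProduct_smul,
    dotProduct_add, Matrix.vecMulVec_mulVec, smul_eq_mul, h1, h2, h3, inner_zero_right]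
  simp
  congr 1
  ring

theorem multivariateGaussian_isotropic (hv : ‖v‖ = 1) :
    multivariateGaussian 0 ((1 / (d : ℝ)) • (1 : Matrix (Fin d) (Fin d) ℝ)) =
      (stdGaussian (EuclideanSpace ℝ (Fin d))).map
        (spikeMap v (Real.sqrt (1 / d)) (Real.sqrt (1 / d))) := by
  simpa using multivariateGaussian_spiked (d := d) hv zero_le_one le_rfl

theorem norm_spikeEquiv_symm_self (hv : ‖v‖ = 1) {p : ℝ} (hp : 0 < p)
    (x : EuclideanSpace ℝ (Fin d)) :
    ‖(spikeEquiv hv hp.ne' hp.ne').symm x‖ = p⁻¹ * ‖x‖ := by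
  change ‖spikeMap v p⁻¹ p⁻¹ x‖ = _
  rw [spikeMap_apply, sub_self, zero_mul, zero_smul, add_zero, norm_smul, Real.norm_eq_abs,
    abs_of_pos (by positivity)]

theorem abs_det_spikeEquiv (hv : ‖v‖ = 1) {p q : ℝ} (hp : 0 < p) (hq : 0 < q) :
    |LinearMap.det (spikeEquiv hv hp.ne' hq.ne' : EuclideanSpace ℝ (Fin d) →ₗ[ℝ] _)|
      = p ^ d * (q / p) := by
  change |LinearMap.det (spikeMap v p q)| = _
  rw [det_spikeMap hv hp.ne', finrank_euclideanSpace_fin, abs_of_pos (by positivity)]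

/-- As `a ≥ 1` and `b ≥ 0`, the spiked covariance dominates the isotropic one, so its inverse square
root is the smaller in norm and the density comparison applies. -/
theorem smul_isotropic_le_spiked (hd : 0 < d) (hv : ‖v‖ = 1) (ha : 1 ≤ a) (hb : 0 ≤ b) :
    ENNReal.ofReal (Real.sqrt a ^ d * Real.sqrt (a + b))⁻¹ •
        multivariateGaussian 0 ((1 / (d : ℝ)) • (1 : Matrix (Fin d) (Fin d) ℝ)) ≤
      multivariateGaussian 0 ((1 / (d : ℝ)) • (a • (1 : Matrix (Fin d) (Fin d) ℝ)
        + b • Matrix.vecMulVec v.ofLp v.ofLp)) := by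
  have hd' : (0 : ℝ) < d := by exact_mod_cast hd
  have hp : 0 < Real.sqrt (a / d) := by positivity
  have hq : 0 < Real.sqrt ((a + b) / d) := by positivity
  have hr : 0 < Real.sqrt (1 / d) := by positivity
  have hrp : Real.sqrt (1 / d) ≤ Real.sqrt (a / d) := by gcongr
  have hrq : Real.sqrt (1 / d) ≤ Real.sqrt ((a + b) / d) := by gcongr; linarith
  have h := smul_map_stdGaussian_le (M₀ := spikeEquiv hv hr.ne' hr.ne')
    (M₁ := spikeEquiv hv hp.ne' hq.ne') fun x => by
      rw [norm_spikeEquiv_symm_self hv hr]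
      exact norm_spikeMap_le hv (by positivity) (by positivity) (by gcongr) (by gcongr) x
  rw [multivariateGaussian_spiked hv (by linarith) hb, multivariateGaussian_isotropic hv]
  refine le_trans (Measure.le_iff'.2 fun s => ?_) h
  change _ * (stdGaussian (EuclideanSpace ℝ (Fin d))).map (spikeMap v _ _) s
    ≤ _ * (stdGaussian (EuclideanSpace ℝ (Fin d))).map (spikeMap v _ _) s
  gcongr
  rw [abs_det_spikeEquiv hv hr hr, abs_det_spikeEquiv hv hp hq, div_self hr.ne', mul_one,
    Real.sqrt_div (by positivity), Real.sqrt_div (by positivity), Real.sqrt_div (by positivity),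
    Real.sqrt_one]
  have hsd : 0 < Real.sqrt d := by positivity
  have hsa : 1 ≤ Real.sqrt a := Real.one_le_sqrt.2 ha
  have hsb : 0 < Real.sqrt (a + b) := by positivity
  -- The exact determinant ratio carries `√a ^ (d - 1)`; the stated constant gives away a factor `√a
  -- ≥ 1` to avoid the exponent `d - 1`.
  have heq : (1 / Real.sqrt d) ^ d / ((Real.sqrt a / Real.sqrt d) ^ d *
      (Real.sqrt (a + b) / Real.sqrt d / (Real.sqrt a / Real.sqrt d)))
      = Real.sqrt a * (Real.sqrt a ^ d * Real.sqrt (a + b))⁻¹ := by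
    rw [div_pow, div_pow, one_pow]
    field_simp
  rw [heq]
  exact le_mul_of_one_le_left (by positivity) hsa

theorem spiked_restrict_le_smul_isotropic (hd : 0 < d) (hv : ‖v‖ = 1) (ha : 1 ≤ a) (hb : 0 ≤ b)
    (r : ℝ) :
    (multivariateGaussian 0 ((1 / (d : ℝ)) • (a • (1 : Matrix (Fin d) (Fin d) ℝ)
        + b • Matrix.vecMulVec v.ofLp v.ofLp))).restrict (Metric.closedBall 0 r) ≤
      ENNReal.ofReal (Real.exp (d * r ^ 2 / 2)) •
        multivariateGaussian 0 ((1 / (d : ℝ)) • (1 : Matrix (Fin d) (Fin d) ℝ)) := by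
  have hd' : (0 : ℝ) < d := by exact_mod_cast hd
  have hp : 0 < Real.sqrt (a / d) := by positivity
  have hq : 0 < Real.sqrt ((a + b) / d) := by positivity
  have hr : 0 < Real.sqrt (1 / d) := by positivity
  have hrp : Real.sqrt (1 / d) ≤ Real.sqrt (a / d) := by gcongr
  have hpq : Real.sqrt (a / d) ≤ Real.sqrt ((a + b) / d) := by gcongr; linarith
  rw [multivariateGaussian_spiked hv (by linarith) hb, multivariateGaussian_isotropic hv]
  refine map_stdGaussian_restrict_le (M₀ := spikeEquiv hv hr.ne' hr.ne')
    (M₁ := spikeEquiv hv hp.ne' hq.ne') ?_ Metric.isClosed_closedBall.measurableSet fun x hx => ?_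
  · rw [abs_det_spikeEquiv hv hr hr, abs_det_spikeEquiv hv hp hq, div_self hr.ne']
    gcongr
    exact (one_le_div hp).2 hpq
  · rw [norm_spikeEquiv_symm_self hv hr, mul_pow, inv_pow, Real.sq_sqrt (by positivity), one_div,
      inv_inv]
    have : ‖x‖ ≤ r := by simpa using hx
    gcongr

/-- Gaussian exponential moments, uniformly in the direction of the spike. -/
theorem exists_spiked_exp_moment (hd : 0 < d) (ha : 1 ≤ a) (hb : 0 ≤ b) :
    ∃ κ : ℝ, 0 < κ ∧ ∀ S L : ℝ, ∃ K : ℝ, 0 ≤ K ∧ ∀ v : EuclideanSpace ℝ (Fin d), ‖v‖ = 1 →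
      Integrable (fun w => (S + L * ‖w‖) ^ 2 * Real.exp (κ * ‖w‖ ^ 2))
        (multivariateGaussian 0 ((1 / (d : ℝ)) • (a • (1 : Matrix (Fin d) (Fin d) ℝ)
          + b • Matrix.vecMulVec v.ofLp v.ofLp))) ∧
      ∫ w, (S + L * ‖w‖) ^ 2 * Real.exp (κ * ‖w‖ ^ 2)
        ∂(multivariateGaussian 0 ((1 / (d : ℝ)) • (a • (1 : Matrix (Fin d) (Fin d) ℝ)
          + b • Matrix.vecMulVec v.ofLp v.ofLp))) ≤ K := by
  obtain ⟨c, hc, hint⟩ := IsGaussian.exists_integrable_exp_sq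
    (stdGaussian (EuclideanSpace ℝ (Fin d)))
  have hd' : (0 : ℝ) < d := by exact_mod_cast hd
  set τ : ℝ := (a + b) / d with hτ
  have hτ0 : 0 < τ := by positivity
  -- `τ` is the largest eigenvalue of the covariance, whatever the direction. The exponent uses only
  -- half of the moment `exp(c ‖z‖²)`; the other half absorbs the quadratic factor through `1 + x ≤
  -- exp x`, and `M` is chosen to match its coefficients.
  refine ⟨c / (2 * τ), by positivity, fun S L => ?_⟩
  set M : ℝ := 2 * S ^ 2 + 4 * L ^ 2 * τ / c with hM
  have hM0 : 0 ≤ M := by positivity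
  refine ⟨∫ z, M * Real.exp (c * ‖z‖ ^ 2) ∂(stdGaussian (EuclideanSpace ℝ (Fin d))),
    integral_nonneg fun z => by positivity, fun v hv => ?_⟩
  rw [multivariateGaussian_spiked hv (by linarith) hb]
  have hcont := (spikeMap v (Real.sqrt (a / d)) (Real.sqrt τ)).continuous_of_finiteDimensional
  have hle : ∀ z, (S + L * ‖spikeMap v (Real.sqrt (a / d)) (Real.sqrt τ) z‖) ^ 2
      * Real.exp (c / (2 * τ) * ‖spikeMap v (Real.sqrt (a / d)) (Real.sqrt τ) z‖ ^ 2)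
      ≤ M * Real.exp (c * ‖z‖ ^ 2) := by
    intro z
    have h1 : ‖spikeMap v (Real.sqrt (a / d)) (Real.sqrt τ) z‖ ^ 2 ≤ τ * ‖z‖ ^ 2 := by
      have := norm_spikeMap_le hv (Real.sqrt_nonneg (a / d)) (Real.sqrt_nonneg τ)
        (by rw [hτ]; gcongr; linarith) le_rfl z
      calc _ ≤ (Real.sqrt τ * ‖z‖) ^ 2 := by gcongr
        _ = _ := by rw [mul_pow, Real.sq_sqrt hτ0.le]
    have h2 : c / (2 * τ) * ‖spikeMap v (Real.sqrt (a / d)) (Real.sqrt τ) z‖ ^ 2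
        ≤ c * ‖z‖ ^ 2 / 2 := by
      calc _ ≤ c / (2 * τ) * (τ * ‖z‖ ^ 2) := by gcongr
        _ = _ := by field_simp
    have h3 : c * ‖z‖ ^ 2 / 2 + 1 ≤ Real.exp (c * ‖z‖ ^ 2 / 2) := Real.add_one_le_exp _
    have h4 : (S + L * ‖spikeMap v (Real.sqrt (a / d)) (Real.sqrt τ) z‖) ^ 2
        ≤ M * Real.exp (c * ‖z‖ ^ 2 / 2) := by
      calc _ ≤ 2 * S ^ 2 + 2 * L ^ 2 * ‖spikeMap v (Real.sqrt (a / d)) (Real.sqrt τ) z‖ ^ 2 := by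
            linarith [sq_nonneg (S - L * ‖spikeMap v (Real.sqrt (a / d)) (Real.sqrt τ) z‖)]
        _ ≤ 2 * S ^ 2 + 2 * L ^ 2 * (τ * ‖z‖ ^ 2) := by gcongr
        _ ≤ M * (c * ‖z‖ ^ 2 / 2 + 1) := by
            have h5 : 4 * L ^ 2 * τ / c * (c * ‖z‖ ^ 2 / 2) = 2 * L ^ 2 * (τ * ‖z‖ ^ 2) := by
              field_simp
              ring
            have h6 : 0 ≤ 2 * S ^ 2 * (c * ‖z‖ ^ 2 / 2) + 4 * L ^ 2 * τ / c := by positivity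
            rw [hM]
            linarith
        _ ≤ _ := by gcongr
    calc _ ≤ M * Real.exp (c * ‖z‖ ^ 2 / 2) * Real.exp (c * ‖z‖ ^ 2 / 2) := by gcongr
      _ = _ := by rw [mul_assoc, ← Real.exp_add, add_halves]
  have hint' := (hint.const_mul M)
  have hmeas : Continuous fun w : EuclideanSpace ℝ (Fin d) =>
      (S + L * ‖w‖) ^ 2 * Real.exp (c / (2 * τ) * ‖w‖ ^ 2) := by fun_prop
  have hcomp : Integrable (fun z => (S + L * ‖spikeMap v (Real.sqrt (a / d)) (Real.sqrt τ) z‖) ^ 2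
      * Real.exp (c / (2 * τ) * ‖spikeMap v (Real.sqrt (a / d)) (Real.sqrt τ) z‖ ^ 2))
      (stdGaussian (EuclideanSpace ℝ (Fin d))) := by
    refine hint'.mono' (hmeas.comp hcont).aestronglyMeasurable (ae_of_all _ fun z => ?_)
    rw [Real.norm_of_nonneg (by positivity)]
    exact hle z
  refine ⟨(integrable_map_measure hmeas.aestronglyMeasurable
    hcont.measurable.aemeasurable).2 hcomp, ?_⟩
  rw [integral_map hcont.measurable.aemeasurable hmeas.aestronglyMeasurable]
  exact integral_mono hcomp hint' hle

end SpikedGaussian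

/-! ### Random features in `L²` and the kernel operators as mixtures -/

section Features

theorem norm_toLp_sq {X : Type*} [MeasurableSpace X] {μ : Measure X} {f : X → ℝ}
    (hf : MemLp f 2 μ) : ‖hf.toLp f‖ ^ 2 = ∫ x, f x ^ 2 ∂μ := by
  rw [← real_inner_self_eq_norm_sq, L2.inner_def]
  refine integral_congr_ae ?_
  filter_upwards [hf.coeFn_toLp] with x hx
  simp [hx, sq]

variable {d : ℕ}

theorem integrable_one_add_norm_sq (d : ℕ) :
    Integrable (fun x : EuclideanSpace ℝ (Fin d) => (1 + ‖x‖) ^ 2) (inputMeasure d) := by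
  simpa using (gaussian_norm_memLp (inputMeasure d) 1 1).integrable_sq

/-- `∫_B (1 + ‖x‖)² dρ(x)` for the input distribution `ρ`. -/
def inputMoment (B : Set (EuclideanSpace ℝ (Fin d))) : ℝ :=
  ∫ x in B, (1 + ‖x‖) ^ 2 ∂(inputMeasure d)

theorem inputMoment_nonneg (B : Set (EuclideanSpace ℝ (Fin d))) : 0 ≤ inputMoment B :=
  integral_nonneg fun _ => sq_nonneg _

theorem inputMoment_mono {B B' : Set (EuclideanSpace ℝ (Fin d))} (h : B ⊆ B') :
    inputMoment B ≤ inputMoment B' :=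
  setIntegral_mono_set (integrable_one_add_norm_sq d).integrableOn
    (ae_of_all _ fun _ => sq_nonneg _) (LE.le.eventuallyLE h)

theorem tendsto_inputMoment_compl_ball (d : ℕ) :
    Tendsto (fun R : ℝ => inputMoment (Metric.ball (0 : EuclideanSpace ℝ (Fin d)) R)ᶜ)
      atTop (nhds 0) := by
  have h := tendsto_setIntegral_of_antitone (μ := inputMeasure d)
    (s := fun R : ℝ => (Metric.ball (0 : EuclideanSpace ℝ (Fin d)) R)ᶜ)
    (f := fun x => (1 + ‖x‖) ^ 2) (fun R => Metric.isOpen_ball.measurableSet.compl)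
    (fun R R' hR => Set.compl_subset_compl.2 (Metric.ball_subset_ball hR))
    ⟨0, (integrable_one_add_norm_sq d).integrableOn⟩
  have hempty : ⋂ R : ℝ, (Metric.ball (0 : EuclideanSpace ℝ (Fin d)) R)ᶜ = ∅ := by
    rw [← Set.compl_iUnion, Set.compl_empty_iff, Set.eq_univ_iff_forall]
    exact fun x => Set.mem_iUnion.2 ⟨‖x‖ + 1, by simp⟩
  rw [hempty, setIntegral_empty] at h
  exact h

variable {L : ℝ≥0} {σ : ℝ → ℝ} {B : Set (EuclideanSpace ℝ (Fin d))}

theorem memLp_of_indicator_growth (hB : MeasurableSet B) {f : EuclideanSpace ℝ (Fin d) → ℝ}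
    (hf : Continuous f) {M : ℝ} (h : ∀ x, |f x| ≤ M * (1 + ‖x‖)) :
    MemLp (B.indicator f) 2 (inputMeasure d) := by
  have hx : MemLp (fun x : EuclideanSpace ℝ (Fin d) => 1 + ‖x‖) 2 (inputMeasure d) := by
    simpa using gaussian_norm_memLp (inputMeasure d) 1 1
  exact MemLp.indicator hB ((hx.const_mul M).mono' hf.aestronglyMeasurable
    (ae_of_all _ h))

theorem integral_indicator_sq_le (hB : MeasurableSet B) {f : EuclideanSpace ℝ (Fin d) → ℝ}
    (hf : Continuous f) {M : ℝ} (h : ∀ x, |f x| ≤ M * (1 + ‖x‖)) :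
    ∫ x, B.indicator f x ^ 2 ∂(inputMeasure d) ≤ M ^ 2 * inputMoment B := by
  have hsq : ∀ x, B.indicator f x ^ 2 = B.indicator (fun x => f x ^ 2) x := fun x => by
    by_cases hx : x ∈ B <;> simp [hx]
  have hint : Integrable (B.indicator fun x => f x ^ 2) (inputMeasure d) := by
    have := (memLp_of_indicator_growth hB hf h).integrable_sq
    simpa only [hsq] using this
  simp_rw [hsq]
  rw [integral_indicator hB, inputMoment, ← integral_const_mul]
  refine integral_mono ((integrable_indicator_iff hB).1 hint)
    ((integrable_one_add_norm_sq d).integrableOn.const_mul _) fun x => ?_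
  change f x ^ 2 ≤ M ^ 2 * (1 + ‖x‖) ^ 2
  rw [← mul_pow, ← sq_abs]
  gcongr
  exact h x

theorem feature_memLp (hσ : LipschitzWith L σ) (hB : MeasurableSet B)
    (w : EuclideanSpace ℝ (Fin d)) :
    MemLp (B.indicator fun x => σ ⟪w, x⟫) 2 (inputMeasure d) :=
  memLp_of_indicator_growth hB (hσ.continuous.comp (by fun_prop)) fun x => lipschitz_growth hσ w x

/-- The random feature `x ↦ σ(⟨w, x⟩)`, restricted to `B`, as an element of `L²(N(0, I_d))`. -/
def feature (hσ : LipschitzWith L σ) (hB : MeasurableSet B) (w : EuclideanSpace ℝ (Fin d)) :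
    Lp ℝ 2 (inputMeasure d) :=
  (feature_memLp hσ hB w).toLp _

theorem norm_feature_sq_le (hσ : LipschitzWith L σ) (hB : MeasurableSet B)
    (w : EuclideanSpace ℝ (Fin d)) :
    ‖feature hσ hB w‖ ^ 2 ≤ (|σ 0| + L * ‖w‖) ^ 2 * inputMoment B := by
  rw [feature, norm_toLp_sq]
  exact integral_indicator_sq_le hB (hσ.continuous.comp (by fun_prop)) (lipschitz_growth hσ w)

theorem norm_feature_le (hσ : LipschitzWith L σ) (hB : MeasurableSet B)
    (w : EuclideanSpace ℝ (Fin d)) :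
    ‖feature hσ hB w‖ ≤ (|σ 0| + L * ‖w‖) * Real.sqrt (inputMoment B) := by
  refine le_of_sq_le_sq ?_ (by positivity)
  rw [mul_pow, Real.sq_sqrt (inputMoment_nonneg B)]
  exact norm_feature_sq_le hσ hB w

theorem feature_univ_sub (hσ : LipschitzWith L σ) (hB : MeasurableSet B)
    (w : EuclideanSpace ℝ (Fin d)) :
    feature hσ MeasurableSet.univ w - feature hσ hB w = feature hσ hB.compl w := by
  rw [feature, feature, feature, ← MemLp.toLp_sub]
  refine MemLp.toLp_congr _ _ (ae_of_all _ fun x => ?_)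
  by_cases hx : x ∈ B <;> simp [hx]

/-- Needed for the measurability of `w ↦ u_w` as an `L²`-valued map; the Lipschitz property of `σ`
makes this map Lipschitz too. -/
theorem feature_continuous (hσ : LipschitzWith L σ) (hB : MeasurableSet B) :
    Continuous (feature hσ hB) := by
  refine (LipschitzWith.of_dist_le_mul (K := L * (Real.sqrt (inputMoment B)).toNNReal)
    fun w w' => ?_).continuous
  rw [dist_eq_norm, dist_eq_norm, NNReal.coe_mul,
    Real.coe_toNNReal _ (Real.sqrt_nonneg _)]
  refine le_of_sq_le_sq ?_ (by positivity)
  have hc : Continuous fun x : EuclideanSpace ℝ (Fin d) => σ ⟪w, x⟫ - σ ⟪w', x⟫ :=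
    (hσ.continuous.comp (by fun_prop)).sub (hσ.continuous.comp (by fun_prop))
  have hb : ∀ x : EuclideanSpace ℝ (Fin d),
      |σ ⟪w, x⟫ - σ ⟪w', x⟫| ≤ L * ‖w - w'‖ * (1 + ‖x‖) := fun x => by
    have h1 : |σ ⟪w, x⟫ - σ ⟪w', x⟫| ≤ L * |⟪w - w', x⟫| := by
      simpa [Real.dist_eq, inner_sub_left] using hσ.dist_le_mul ⟪w, x⟫ ⟪w', x⟫
    calc _ ≤ _ := h1
      _ ≤ L * (‖w - w'‖ * ‖x‖) := by gcongr; exact abs_real_inner_le_norm _ _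
      _ ≤ L * (‖w - w'‖ * (1 + ‖x‖)) := by gcongr; linarith
      _ = _ := by ring
  have h := integral_indicator_sq_le hB hc hb
  rw [feature, feature, ← MemLp.toLp_sub, norm_toLp_sq]
  rw [mul_right_comm, mul_pow _ (Real.sqrt _), Real.sq_sqrt (inputMoment_nonneg B)]
  refine le_trans (le_of_eq (integral_congr_ae (ae_of_all _ fun x => ?_))) h
  by_cases hx : x ∈ B <;> simp [hx]

theorem memLp_feature (hσ : LipschitzWith L σ) (hB : MeasurableSet B)
    (ν : Measure (EuclideanSpace ℝ (Fin d))) [IsGaussian ν] : MemLp (feature hσ hB) 2 ν :=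
  ((gaussian_norm_memLp ν |σ 0| L).mul_const (Real.sqrt (inputMoment B))).mono'
    (feature_continuous hσ hB).aestronglyMeasurable (ae_of_all _ fun w => norm_feature_le hσ hB w)

theorem integrable_one_add_norm_mul (f : Lp ℝ 2 (inputMeasure d)) :
    Integrable (fun x => (1 + ‖x‖) * ‖f x‖) (inputMeasure d) := by
  have hx : MemLp (fun x : EuclideanSpace ℝ (Fin d) => 1 + ‖x‖) 2 (inputMeasure d) := by
    simpa using gaussian_norm_memLp (inputMeasure d) 1 1
  exact hx.integrable_mul (Lp.memLp f).norm

theorem inner_feature (hσ : LipschitzWith L σ) (hB : MeasurableSet B)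
    (w : EuclideanSpace ℝ (Fin d)) (f : Lp ℝ 2 (inputMeasure d)) :
    ⟪feature hσ hB w, f⟫ = ∫ x, B.indicator (fun x => σ ⟪w, x⟫) x * f x ∂(inputMeasure d) := by
  rw [L2.inner_def]
  refine integral_congr_ae ?_
  filter_upwards [(feature_memLp hσ hB w).coeFn_toLp] with x hx
  rw [feature, hx]
  simp [mul_comm]

/-- The integral operator of the kernel `E_w[u_w(x) u_w(x')]` is the mean of `u_w ⊗ u_w`. -/
theorem integralOp_eq_mixtureOp (hσ : LipschitzWith L σ) (hB : MeasurableSet B)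
    (ν : Measure (EuclideanSpace ℝ (Fin d))) [IsGaussian ν]
    {k : EuclideanSpace ℝ (Fin d) → EuclideanSpace ℝ (Fin d) → ℝ}
    (hk : MemLp (Function.uncurry k) 2 ((inputMeasure d).prod (inputMeasure d)))
    (hkB : ∀ x y, k x y = ∫ w, B.indicator (fun x => σ ⟪w, x⟫) x *
      B.indicator (fun x => σ ⟪w, x⟫) y ∂ν) :
    integralOp k hk = mixtureOp ν (feature hσ hB) := by
  refine ContinuousLinearMap.ext fun g => ext_inner_left ℝ fun f => ?_
  rw [inner_mixtureOp (memLp_feature hσ hB ν)]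
  let φ : EuclideanSpace ℝ (Fin d) → EuclideanSpace ℝ (Fin d) → ℝ :=
    fun w => B.indicator fun x => σ ⟪w, x⟫
  have hφ : ∀ w x, |φ w x| ≤ (|σ 0| + L * ‖w‖) * (1 + ‖x‖) := fun w x => by
    by_cases hx : x ∈ B
    · simpa [φ, hx] using lipschitz_growth hσ w x
    · simp only [φ, hx, not_false_eq_true, Set.indicator_of_notMem, abs_zero]
      positivity
  have hφm : StronglyMeasurable (Function.uncurry φ) := by
    have h1 : Function.uncurry φ = (Set.univ ×ˢ B).indicator fun p => σ ⟪p.1, p.2⟫ := by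
      ext ⟨w, x⟩
      by_cases hx : x ∈ B <;> simp [φ, hx]
    rw [h1]
    exact (hσ.continuous.comp (by fun_prop : Continuous fun p : EuclideanSpace ℝ (Fin d) ×
      EuclideanSpace ℝ (Fin d) => ⟪p.1, p.2⟫)).stronglyMeasurable.indicator
        (MeasurableSet.univ.prod hB)
  let P : EuclideanSpace ℝ (Fin d) → EuclideanSpace ℝ (Fin d) × EuclideanSpace ℝ (Fin d) → ℝ :=
    fun w z => (φ w z.1 * f z.1) * (φ w z.2 * g z.2)
  have hPint : Integrable (Function.uncurry P)
      (ν.prod ((inputMeasure d).prod (inputMeasure d))) := by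
    -- Linear growth of `σ` separates the variables: the dominating function is a product of
    -- integrable functions of `w`, `x` and `y`, which justifies Fubini.
    have hdom := (gaussian_norm_memLp ν |σ 0| L).integrable_sq.mul_prod
      ((integrable_one_add_norm_mul f).mul_prod (integrable_one_add_norm_mul g))
    refine hdom.mono' ?_ (ae_of_all _ fun p => ?_)
    · have h1 : AEStronglyMeasurable (fun p : EuclideanSpace ℝ (Fin d) ×
          EuclideanSpace ℝ (Fin d) × EuclideanSpace ℝ (Fin d) => φ p.1 p.2.1)
          (ν.prod ((inputMeasure d).prod (inputMeasure d))) :=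
        (hφm.comp_measurable (by fun_prop : Measurable fun p : EuclideanSpace ℝ (Fin d) ×
          EuclideanSpace ℝ (Fin d) × EuclideanSpace ℝ (Fin d) =>
            (p.1, p.2.1))).aestronglyMeasurable
      have h2 : AEStronglyMeasurable (fun p : EuclideanSpace ℝ (Fin d) ×
          EuclideanSpace ℝ (Fin d) × EuclideanSpace ℝ (Fin d) => φ p.1 p.2.2)
          (ν.prod ((inputMeasure d).prod (inputMeasure d))) :=
        (hφm.comp_measurable (by fun_prop : Measurable fun p : EuclideanSpace ℝ (Fin d) ×
          EuclideanSpace ℝ (Fin d) × EuclideanSpace ℝ (Fin d) =>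
            (p.1, p.2.2))).aestronglyMeasurable
      have h3 := ((Lp.aestronglyMeasurable f).comp_fst (ν := inputMeasure d)).comp_snd (μ := ν)
      have h4 := ((Lp.aestronglyMeasurable g).comp_snd (μ := inputMeasure d)).comp_snd (μ := ν)
      exact (h1.mul h3).mul (h2.mul h4)
    · obtain ⟨w, x, y⟩ := p
      have h1 := hφ w x
      have h2 := hφ w y
      simp only [P, Function.uncurry, norm_mul, Real.norm_eq_abs]
      calc |φ w x| * |f x| * (|φ w y| * |g y|)
          ≤ ((|σ 0| + L * ‖w‖) * (1 + ‖x‖)) * |f x| *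
              (((|σ 0| + L * ‖w‖) * (1 + ‖y‖)) * |g y|) := by gcongr
        _ = _ := by ring
  have hl : ⟪f, integralOp k hk g⟫
      = ∫ x, ∫ y, ∫ w, P w (x, y) ∂ν ∂(inputMeasure d) ∂(inputMeasure d) := by
    rw [L2.inner_def]
    refine integral_congr_ae ?_
    filter_upwards [integralOp_apply_ae k hk g] with x hx
    simp only [hx, RCLike.inner_apply, conj_trivial]
    rw [mul_comm, ← integral_const_mul]
    refine integral_congr_ae (ae_of_all _ fun y => ?_)
    simp only [hkB, P, φ]
    rw [← integral_mul_const, ← integral_const_mul]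
    refine integral_congr_ae (ae_of_all _ fun w => ?_)
    simp only
    ring
  have hPsw : Integrable (fun z => ∫ w, P w z ∂ν) ((inputMeasure d).prod (inputMeasure d)) :=
    hPint.integral_prod_right
  rw [hl, ← integral_prod (fun z => ∫ w, P w z ∂ν) hPsw,
    ← integral_integral_swap (f := P) hPint]
  refine integral_congr_ae (ae_of_all _ fun w => ?_)
  simp only [inner_feature]
  exact integral_prod_mul (fun x => φ w x * f x) fun y => φ w y * g y

theorem conjOp_eq_mixtureOp (hσ : LipschitzWith L σ) (S : Matrix (Fin d) (Fin d) ℝ) :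
    conjOp hσ S = mixtureOp (multivariateGaussian 0 S) (feature hσ MeasurableSet.univ) :=
  integralOp_eq_mixtureOp hσ _ _ _ fun x y => by simp [conjKernel]

theorem truncConjOp_eq_mixtureOp (hσ : LipschitzWith L σ) (S : Matrix (Fin d) (Fin d) ℝ) (R : ℝ)
    (hR : MeasurableSet (Metric.ball (0 : EuclideanSpace ℝ (Fin d)) R)) :
    truncConjOp hσ S R = mixtureOp (multivariateGaussian 0 S) (feature hσ hR) := by
  refine integralOp_eq_mixtureOp hσ hR _ _ fun x y => ?_
  by_cases hx : x ∈ Metric.ball (0 : EuclideanSpace ℝ (Fin d)) R <;>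
  by_cases hy : y ∈ Metric.ball (0 : EuclideanSpace ℝ (Fin d)) R <;>
  simp only [truncKernel, conjKernel, Function.uncurry, Set.indicator, Set.mem_prod, hx, hy,
    and_self, and_true, and_false, if_true, if_false, mul_zero, zero_mul, integral_zero]

end Features

/-! ### From weight laws to eigenvalues -/

section Comparison

variable {d : ℕ} {L : ℝ≥0} {σ : ℝ → ℝ}

theorem conjOp_isPositive (hσ : LipschitzWith L σ) (Q : Matrix (Fin d) (Fin d) ℝ) :
    (conjOp hσ Q).IsPositive := by
  rw [conjOp_eq_mixtureOp]
  exact mixtureOp_isPositive (memLp_feature hσ _ _)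

theorem conjOp_isCompactOperator (hσ : LipschitzWith L σ) (Q : Matrix (Fin d) (Fin d) ℝ) :
    IsCompactOperator (conjOp hσ Q) := by
  rw [conjOp_eq_mixtureOp]
  exact mixtureOp_isCompactOperator (memLp_feature hσ _ _)

theorem inner_conjOp (hσ : LipschitzWith L σ) (Q : Matrix (Fin d) (Fin d) ℝ)
    (f : Lp ℝ 2 (inputMeasure d)) :
    ⟪f, conjOp hσ Q f⟫ =
      ∫ w, ⟪feature hσ MeasurableSet.univ w, f⟫ ^ 2 ∂(multivariateGaussian 0 Q) := by
  rw [conjOp_eq_mixtureOp, inner_self_mixtureOp (memLp_feature hσ _ _)]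

theorem tendsto_sortedEigenvalue_conjOp (hσ : LipschitzWith L σ) (Q : Matrix (Fin d) (Fin d) ℝ) :
    Tendsto (fun j => sortedEigenvalue (conjOp hσ Q) j) atTop (nhds 0) := by
  rw [conjOp_eq_mixtureOp]
  refine squeeze_zero (fun j => sortedEigenvalue_nonneg _ j)
    (fun j => sortedEigenvalue_mixtureOp_le (memLp_feature hσ _ _) j) ?_
  exact tendsto_const_nhds.div_atTop
    (tendsto_atTop_add_const_right _ _ tendsto_natCast_atTop_atTop)

/-- The forms differ by the mean of `⟨u, f⟩² - ⟨u', f⟩² = ⟨u + u', f⟩ ⟨u - u', f⟩`, where `u - u'`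
is the feature restricted to the outside of the ball and is small in `L²`. -/
theorem abs_sortedEigenvalue_conjOp_sub_truncConjOp_le (hσ : LipschitzWith L σ)
    (Q : Matrix (Fin d) (Fin d) ℝ) {S K : ℝ} (hS : |σ 0| ≤ S)
    (hint : Integrable (fun w => (S + L * ‖w‖) ^ 2) (multivariateGaussian 0 Q))
    (hK : ∫ w, (S + L * ‖w‖) ^ 2 ∂(multivariateGaussian 0 Q) ≤ K) (R : ℝ) (j : ℕ) :
    |sortedEigenvalue (conjOp hσ Q) j - sortedEigenvalue (truncConjOp hσ Q R) j| ≤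
      K * (2 * Real.sqrt (inputMoment (Set.univ : Set (EuclideanSpace ℝ (Fin d)))) *
        Real.sqrt (inputMoment (Metric.ball (0 : EuclideanSpace ℝ (Fin d)) R)ᶜ)) := by
  have hR : MeasurableSet (Metric.ball (0 : EuclideanSpace ℝ (Fin d)) R) :=
    Metric.isOpen_ball.measurableSet
  have hu := memLp_feature hσ MeasurableSet.univ (multivariateGaussian 0 Q)
  have hv := memLp_feature hσ hR (multivariateGaussian 0 Q)
  have hK0 : 0 ≤ K := (integral_nonneg fun _ => sq_nonneg _).trans hK
  rw [conjOp_eq_mixtureOp, truncConjOp_eq_mixtureOp hσ Q R hR]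
  refine abs_sortedEigenvalue_sub_le (mixtureOp_isPositive hu) (mixtureOp_isCompactOperator hu)
    (mixtureOp_isPositive hv) (mixtureOp_isCompactOperator hv) (by positivity) (fun f => ?_) j
  set m := Real.sqrt (inputMoment (Set.univ : Set (EuclideanSpace ℝ (Fin d))))
  set m' := Real.sqrt (inputMoment (Metric.ball (0 : EuclideanSpace ℝ (Fin d)) R)ᶜ)
  rw [inner_self_mixtureOp hu, inner_self_mixtureOp hv,
    ← integral_sub (memLp_inner hu f).integrable_sq (memLp_inner hv f).integrable_sq]
  have hpt : ∀ w, ‖⟪feature hσ MeasurableSet.univ w, f⟫ ^ 2 - ⟪feature hσ hR w, f⟫ ^ 2‖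
      ≤ (S + L * ‖w‖) ^ 2 * (2 * m * m' * ‖f‖ ^ 2) := by
    intro w
    have hφ : |σ 0| + L * ‖w‖ ≤ S + L * ‖w‖ := by gcongr
    have h0 : 0 ≤ S + L * ‖w‖ := le_trans (by positivity) hφ
    have h1 : ‖feature hσ MeasurableSet.univ w‖ ≤ (S + L * ‖w‖) * m :=
      (norm_feature_le hσ _ w).trans (by gcongr)
    have h2 : ‖feature hσ hR w‖ ≤ (S + L * ‖w‖) * m :=
      (norm_feature_le hσ _ w).trans (by
        gcongr
        exact Real.sqrt_le_sqrt (inputMoment_mono (Set.subset_univ _)))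
    have h3 : ‖feature hσ MeasurableSet.univ w - feature hσ hR w‖ ≤ (S + L * ‖w‖) * m' := by
      rw [feature_univ_sub]
      exact (norm_feature_le hσ _ w).trans (by gcongr)
    rw [sq_sub_sq, ← inner_add_left, ← inner_sub_left, norm_mul]
    calc _ ≤ ‖feature hσ MeasurableSet.univ w + feature hσ hR w‖ * ‖f‖ *
          (‖feature hσ MeasurableSet.univ w - feature hσ hR w‖ * ‖f‖) := by
          gcongr <;> exact norm_inner_le_norm _ _
      _ ≤ ((S + L * ‖w‖) * m + (S + L * ‖w‖) * m) * ‖f‖ * ((S + L * ‖w‖) * m' * ‖f‖) := by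
          gcongr
          exact (norm_add_le _ _).trans (add_le_add h1 h2)
      _ = _ := by ring
  have h := norm_integral_le_of_norm_le (hint.mul_const _) (ae_of_all _ hpt)
  rw [Real.norm_eq_abs, integral_mul_const] at h
  calc _ ≤ _ := h
    _ ≤ K * (2 * m * m' * ‖f‖ ^ 2) := by gcongr
    _ = _ := by ring

theorem mul_sortedEigenvalue_conjOp_le (hσ : LipschitzWith L σ) {Q₀ Q₁ : Matrix (Fin d) (Fin d) ℝ}
    {c : ℝ} (hc : 0 < c)
    (h : ENNReal.ofReal c • multivariateGaussian 0 Q₀ ≤ multivariateGaussian 0 Q₁) (j : ℕ) :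
    c * sortedEigenvalue (conjOp hσ Q₀) j ≤ sortedEigenvalue (conjOp hσ Q₁) j := by
  have h1 := sortedEigenvalue_le_of_inner_le (conjOp_isPositive hσ Q₁)
    (conjOp_isCompactOperator hσ Q₁) (conjOp_isPositive hσ Q₀) (conjOp_isCompactOperator hσ Q₀)
    (inv_pos.2 hc) le_rfl (fun f => by
      rw [inner_conjOp, inner_conjOp, zero_mul, add_zero]
      have h2 := integral_mono_measure h (ae_of_all _ fun w =>
        sq_nonneg ⟪feature hσ MeasurableSet.univ w, f⟫)
        (memLp_inner (memLp_feature hσ MeasurableSet.univ _) f).integrable_sq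
      rw [integral_smul_measure, ENNReal.toReal_ofReal hc.le, smul_eq_mul] at h2
      rwa [inv_mul_eq_div, le_div_iff₀ hc, mul_comm]) j
  rw [add_zero, inv_mul_eq_div, le_div_iff₀ hc] at h1
  linarith

/-- The form of `Q₁` is split at `‖w‖ = r`. Inside, the measures compare; outside, the Chernoff
factor `exp(κ (‖w‖² - r²)) ≥ 1` is inserted and the exponential moment is used. -/
theorem sortedEigenvalue_conjOp_le (hσ : LipschitzWith L σ) {Q₀ Q₁ : Matrix (Fin d) (Fin d) ℝ}
    {C r : ℝ} (hC : 0 < C) (hr : 0 ≤ r)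
    (h : (multivariateGaussian 0 Q₁).restrict (Metric.closedBall 0 r) ≤
      ENNReal.ofReal C • multivariateGaussian 0 Q₀)
    {S κ K : ℝ} (hκ : 0 ≤ κ) (hS : |σ 0| ≤ S)
    (hint : Integrable (fun w => (S + L * ‖w‖) ^ 2 * Real.exp (κ * ‖w‖ ^ 2))
      (multivariateGaussian 0 Q₁))
    (hK : ∫ w, (S + L * ‖w‖) ^ 2 * Real.exp (κ * ‖w‖ ^ 2) ∂(multivariateGaussian 0 Q₁) ≤ K)
    (j : ℕ) :
    sortedEigenvalue (conjOp hσ Q₁) j ≤ C * sortedEigenvalue (conjOp hσ Q₀) j +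
      inputMoment (Set.univ : Set (EuclideanSpace ℝ (Fin d))) * K * Real.exp (-κ * r ^ 2) := by
  have hm := inputMoment_nonneg (Set.univ : Set (EuclideanSpace ℝ (Fin d)))
  have hK0 : 0 ≤ K := (integral_nonneg fun _ => by positivity).trans hK
  refine sortedEigenvalue_le_of_inner_le (conjOp_isPositive hσ Q₀) (conjOp_isCompactOperator hσ Q₀)
    (conjOp_isPositive hσ Q₁) (conjOp_isCompactOperator hσ Q₁) hC (by positivity) (fun f => ?_) j
  rw [inner_conjOp, inner_conjOp]
  set m := inputMoment (Set.univ : Set (EuclideanSpace ℝ (Fin d)))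
  have h0 := (memLp_inner (memLp_feature hσ MeasurableSet.univ
    (multivariateGaussian 0 Q₀)) f).integrable_sq
  have h1 := (memLp_inner (memLp_feature hσ MeasurableSet.univ
    (multivariateGaussian 0 Q₁)) f).integrable_sq
  have hball : MeasurableSet (Metric.closedBall (0 : EuclideanSpace ℝ (Fin d)) r) :=
    Metric.isClosed_closedBall.measurableSet
  rw [← integral_add_compl hball h1]
  refine add_le_add ?_ ?_
  · have h2 := integral_mono_measure h (ae_of_all _ fun w =>
      sq_nonneg ⟪feature hσ MeasurableSet.univ w, f⟫) (h0.smul_measure ENNReal.ofReal_ne_top)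
    rwa [integral_smul_measure, ENNReal.toReal_ofReal hC.le, smul_eq_mul] at h2
  · have hpt : ∀ w ∈ (Metric.closedBall (0 : EuclideanSpace ℝ (Fin d)) r)ᶜ,
        ⟪feature hσ MeasurableSet.univ w, f⟫ ^ 2 ≤
          (S + L * ‖w‖) ^ 2 * Real.exp (κ * ‖w‖ ^ 2) * (m * Real.exp (-κ * r ^ 2) * ‖f‖ ^ 2) := by
      intro w hw
      have hw' : r ≤ ‖w‖ := by
        have : r < ‖w‖ := by simpa using hw
        exact this.le
      have hφ : |σ 0| + L * ‖w‖ ≤ S + L * ‖w‖ := by gcongr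
      have h3 : 1 ≤ Real.exp (κ * ‖w‖ ^ 2) * Real.exp (-κ * r ^ 2) := by
        rw [← Real.exp_add, Real.one_le_exp_iff]
        have : κ * r ^ 2 ≤ κ * ‖w‖ ^ 2 := by gcongr
        linarith
      have h4 : ‖feature hσ MeasurableSet.univ w‖ ^ 2 ≤ (S + L * ‖w‖) ^ 2 * m :=
        (norm_feature_sq_le hσ _ w).trans (by gcongr)
      calc ⟪feature hσ MeasurableSet.univ w, f⟫ ^ 2
          ≤ (‖feature hσ MeasurableSet.univ w‖ * ‖f‖) ^ 2 := by
            rw [← sq_abs]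
            gcongr
            exact abs_real_inner_le_norm _ _
        _ = ‖feature hσ MeasurableSet.univ w‖ ^ 2 * ‖f‖ ^ 2 * 1 := by ring
        _ ≤ (S + L * ‖w‖) ^ 2 * m * ‖f‖ ^ 2 *
            (Real.exp (κ * ‖w‖ ^ 2) * Real.exp (-κ * r ^ 2)) := by gcongr
        _ = _ := by ring
    have hint' := hint.mul_const (m * Real.exp (-κ * r ^ 2) * ‖f‖ ^ 2)
    calc _ ≤ ∫ w in (Metric.closedBall (0 : EuclideanSpace ℝ (Fin d)) r)ᶜ,
          (S + L * ‖w‖) ^ 2 * Real.exp (κ * ‖w‖ ^ 2) * (m * Real.exp (-κ * r ^ 2) * ‖f‖ ^ 2)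
          ∂(multivariateGaussian 0 Q₁) :=
          setIntegral_mono_on h1.integrableOn hint'.integrableOn hball.compl hpt
      _ ≤ ∫ w, (S + L * ‖w‖) ^ 2 * Real.exp (κ * ‖w‖ ^ 2) *
          (m * Real.exp (-κ * r ^ 2) * ‖f‖ ^ 2) ∂(multivariateGaussian 0 Q₁) :=
          setIntegral_le_integral hint' (ae_of_all _ fun w => by positivity)
      _ ≤ K * (m * Real.exp (-κ * r ^ 2) * ‖f‖ ^ 2) := by
          rw [integral_mul_const]
          gcongr
      _ = _ := by ring

theorem moment_le_of_exp_moment {Q : Matrix (Fin d) (Fin d) ℝ} {S M κ K : ℝ} (hκ : 0 ≤ κ)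
    (hint : Integrable (fun w => (S + M * ‖w‖) ^ 2 * Real.exp (κ * ‖w‖ ^ 2))
      (multivariateGaussian (0 : EuclideanSpace ℝ (Fin d)) Q))
    (hK : ∫ w, (S + M * ‖w‖) ^ 2 * Real.exp (κ * ‖w‖ ^ 2)
      ∂(multivariateGaussian (0 : EuclideanSpace ℝ (Fin d)) Q) ≤ K) :
    Integrable (fun w => (S + M * ‖w‖) ^ 2)
        (multivariateGaussian (0 : EuclideanSpace ℝ (Fin d)) Q) ∧
      ∫ w, (S + M * ‖w‖) ^ 2 ∂(multivariateGaussian (0 : EuclideanSpace ℝ (Fin d)) Q) ≤ K := by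
  have h := (gaussian_norm_memLp (multivariateGaussian (0 : EuclideanSpace ℝ (Fin d)) Q)
    S M).integrable_sq
  refine ⟨h, (integral_mono h hint fun w => ?_).trans hK⟩
  exact le_mul_of_one_le_right (sq_nonneg _) (Real.one_le_exp (by positivity))

end Comparison

/-! ### Logarithmic equivalence of two sequences -/

section LogDecay

variable {a b : ℕ → ℝ} {c D K κ : ℝ}

theorem eq_zero_iff_of_comparison (hb : ∀ j, 0 ≤ b j) (ha : ∀ j, 0 ≤ a j) (hc : 0 < c)
    (hκ : 0 < κ) (h1 : ∀ j, c * a j ≤ b j)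
    (h2 : ∀ j r, 0 ≤ r → b j ≤ Real.exp (D * r ^ 2 / 2) * a j + K * Real.exp (-κ * r ^ 2))
    (j : ℕ) : a j = 0 ↔ b j = 0 := by
  constructor
  · intro h
    have hlim : Tendsto (fun r : ℝ => K * Real.exp (-κ * r ^ 2)) atTop (nhds (K * 0)) := by
      refine Tendsto.const_mul K (Real.tendsto_exp_atBot.comp ?_)
      exact (tendsto_pow_atTop two_ne_zero).const_mul_atTop_of_neg (neg_lt_zero.2 hκ)
    rw [mul_zero] at hlim
    refine le_antisymm (ge_of_tendsto hlim ?_) (hb j)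
    filter_upwards [eventually_ge_atTop 0] with r hr
    simpa [h] using h2 j r hr
  · intro h
    have := h1 j
    rw [h] at this
    exact le_antisymm (nonpos_of_mul_nonpos_right this hc) (ha j)

/-- The cutoff is optimized for each `j`: with `r² = -log a_j / D` the two terms become `a_j ^
(1/2)` and `K a_j ^ (κ / D)`, so `b_j ≤ (1 + K) a_j ^ p` once `a_j < 1`. Together with `c a_j ≤ b_j`
this bounds the logarithms both ways. -/
theorem isTheta_log_of_comparison (ha : ∀ j, 0 ≤ a j) (hb : ∀ j, 0 ≤ b j)
    (ha0 : Tendsto a atTop (nhds 0)) (hb0 : Tendsto b atTop (nhds 0)) (hc : 0 < c) (hD : 0 < D)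
    (hK : 0 ≤ K) (hκ : 0 < κ) (h1 : ∀ j, c * a j ≤ b j)
    (h2 : ∀ j r, 0 ≤ r → b j ≤ Real.exp (D * r ^ 2 / 2) * a j + K * Real.exp (-κ * r ^ 2)) :
    (fun j => Real.log (b j)) =Θ[atTop] fun j => Real.log (a j) := by
  have hiff := eq_zero_iff_of_comparison hb ha hc hκ h1 h2
  have hsmall : ∀ M : ℝ, ∀ᶠ j in atTop, a j < Real.exp (-M) := fun M =>
    ha0.eventually_lt_const (Real.exp_pos _)
  have hlog : ∀ {M x : ℝ}, 0 < x → x < Real.exp (-M) → M < -Real.log x := by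
    intro M x hx h
    have := Real.log_lt_log hx h
    rw [Real.log_exp] at this
    linarith
  constructor
  · refine Asymptotics.IsBigO.of_bound 2 ?_
    -- Once `|log a_j|` exceeds `|log c|`, the lower bound gives `|log b_j| ≤ 2 |log a_j|`. Zero
    -- terms vanish together and `log 0 = 0`.
    filter_upwards [hsmall |Real.log c|, hb0.eventually_lt_const one_pos] with j hj hbj
    rcases (ha j).eq_or_lt' with h | h
    · simp [h, (hiff j).1 h]
    have hb' : 0 < b j := (mul_pos hc h).trans_le (h1 j)
    have h3 := hlog h hj
    have h4 := Real.log_le_log (mul_pos hc h) (h1 j)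
    rw [Real.log_mul hc.ne' h.ne'] at h4
    have h5 := Real.log_neg hb' hbj
    have h6 := neg_abs_le (Real.log c)
    have h7 := neg_le_abs (Real.log (a j))
    rw [Real.norm_eq_abs, Real.norm_eq_abs, abs_of_neg h5]
    linarith
  · set p := min (1 / 2) (κ / D) with hp
    have hp0 : 0 < p := by positivity
    refine Asymptotics.IsBigO.of_bound (2 / p) ?_
    -- Beyond this threshold `log (1 + K)` is at most half of `p |log a_j|`, whence the constant `2
    -- / p`.
    filter_upwards [hsmall (2 * Real.log (1 + K) / p), hsmall 0] with j hj hj'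
    rcases (ha j).eq_or_lt' with h | h
    · simp [h, (hiff j).1 h]
    have hb' : 0 < b j := (mul_pos hc h).trans_le (h1 j)
    have h3 := hlog h hj
    have h4 := hlog h hj'
    set l := Real.log (a j) with hl
    have h5 := h2 j (Real.sqrt (-l / D)) (Real.sqrt_nonneg _)
    rw [Real.sq_sqrt (by positivity)] at h5
    have h6 : b j ≤ (1 + K) * Real.exp (p * l) := by
      have e1 : Real.exp (D * (-l / D) / 2) * a j = Real.exp (1 / 2 * l) := by
        rw [show D * (-l / D) / 2 = -l / 2 by field_simp]
        rw [show a j = Real.exp l from (Real.exp_log h).symm, ← Real.exp_add]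
        congr 1
        ring
      have e2 : -κ * (-l / D) = κ / D * l := by ring
      rw [e1, e2] at h5
      have e3 : Real.exp (1 / 2 * l) ≤ Real.exp (p * l) := Real.exp_le_exp.2
        (mul_le_mul_of_nonpos_right (min_le_left _ _) (by linarith))
      have e4 : Real.exp (κ / D * l) ≤ Real.exp (p * l) := Real.exp_le_exp.2
        (mul_le_mul_of_nonpos_right (min_le_right _ _) (by linarith))
      calc b j ≤ _ := h5
        _ ≤ Real.exp (p * l) + K * Real.exp (p * l) := by gcongr
        _ = _ := by ring
    have h7 := Real.log_le_log hb' h6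
    rw [Real.log_mul (by positivity) (Real.exp_pos _).ne', Real.log_exp] at h7
    rw [div_lt_iff₀ hp0] at h3
    rw [Real.norm_eq_abs, Real.norm_eq_abs, abs_of_neg (by linarith : l < 0), div_mul_eq_mul_div,
      le_div_iff₀ hp0]
    have h8 := neg_le_abs (Real.log (b j))
    linarith

end LogDecay

/-! ### Size of the covariance coefficients -/

section Coefficients

/-- The step-size factor `η² / d = ηt² d^(2 ζ - 1)` for `η = ηt d^ζ`. -/
def stepFactor (ηt ζ : ℝ) (d : ℕ) : ℝ := ηt ^ 2 * (d : ℝ) ^ (2 * ζ - 1)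

/-- `d (A - 1)`, where `A` is the isotropic coefficient of the covariance. -/
def isotropicExcess (g : ℝ → ℝ) (v α β ηt ζ : ℝ) (d : ℕ) : ℝ :=
  stepFactor ηt ζ d * (hermiteOne g ^ 2 / (α * β ^ 2)) * (∫ z, g z ^ 2 ∂(gaussianReal 0 1) + v)

/-- An upper bound of the spike coefficient `B` of the covariance. -/
def spikeBound (g : ℝ → ℝ) (α β ηt ζ : ℝ) (d : ℕ) : ℝ :=
  stepFactor ηt ζ d * (hermiteOne g ^ 4 / (α * β ^ 2)) *
    (α + 2 * |spikeCoef g| / hermiteOne g ^ 2)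

variable {g : ℝ → ℝ} {v α β ηt ζ : ℝ} {d : ℕ}

theorem stepFactor_nonneg (ηt ζ : ℝ) (d : ℕ) : 0 ≤ stepFactor ηt ζ d := by
  unfold stepFactor
  positivity

theorem sq_step_div (hd : 0 < d) :
    (ηt * (d : ℝ) ^ ζ) ^ 2 / (d : ℝ) = stepFactor ηt ζ d := by
  have hd' : (0 : ℝ) < d := by exact_mod_cast hd
  rw [stepFactor, mul_pow, ← Real.rpow_natCast ((d : ℝ) ^ ζ), ← Real.rpow_mul hd'.le,
    Real.rpow_sub_one hd'.ne', mul_div_assoc]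
  push_cast
  rw [mul_comm ζ 2]

theorem isotropicExcess_nonneg (hα : 0 < α) (hv : 0 ≤ v) (d : ℕ) :
    0 ≤ isotropicExcess g v α β ηt ζ d := by
  have h1 := stepFactor_nonneg ηt ζ d
  have h2 : 0 ≤ ∫ z, g z ^ 2 ∂(gaussianReal 0 1) := integral_nonneg fun _ => sq_nonneg _
  unfold isotropicExcess
  positivity

theorem spikeBound_nonneg (hα : 0 < α) (d : ℕ) : 0 ≤ spikeBound g α β ηt ζ d := by
  have h1 := stepFactor_nonneg ηt ζ d
  have h2 : 0 ≤ hermiteOne g ^ 4 := by positivity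
  unfold spikeBound
  positivity

theorem covA_eq (hd : 0 < d) :
    covA g v α β (ηt * (d : ℝ) ^ ζ) d = 1 + isotropicExcess g v α β ηt ζ d / d := by
  have hd' : (0 : ℝ) < d := by exact_mod_cast hd
  rw [covA, isotropicExcess, ← sq_step_div hd]
  field_simp
  ring

theorem covB_le_spikeBound (hα : 0 < α) (hd : 0 < d) :
    covB g α β (ηt * (d : ℝ) ^ ζ) d ≤ spikeBound g α β ηt ζ d := by
  have hd' : (1 : ℝ) ≤ d := by exact_mod_cast hd
  have h1 := stepFactor_nonneg ηt ζ d
  have h2 : 0 ≤ hermiteOne g ^ 4 := by positivity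
  rw [covB, spikeBound, sq_step_div hd]
  have h3 : 2 * spikeCoef g / (hermiteOne g ^ 2 * d) ≤ 2 * |spikeCoef g| / hermiteOne g ^ 2 := by
    rw [← div_div]
    calc _ ≤ 2 * |spikeCoef g| / hermiteOne g ^ 2 / d := by gcongr; exact le_abs_self _
      _ ≤ _ := div_le_self (by positivity) hd'
  have h4 : 0 ≤ 1 / (d : ℝ) := by positivity
  gcongr
  linarith

/-- The bracket in `B` can be negative for small `d`; the hypothesis makes `α` outweigh the terms of
order `1 / d`. This is the source of `d₀`. -/
theorem covB_nonneg (hα : 0 < α) (hd : 0 < d)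
    (h : (1 + 2 * |spikeCoef g| / hermiteOne g ^ 2) / α ≤ d) :
    0 ≤ covB g α β (ηt * (d : ℝ) ^ ζ) d := by
  have hd' : (0 : ℝ) < d := by exact_mod_cast hd
  have h1 := stepFactor_nonneg ηt ζ d
  have h2 : 0 ≤ hermiteOne g ^ 4 := by positivity
  rw [covB, sq_step_div hd]
  refine mul_nonneg (by positivity) ?_
  rw [div_le_iff₀ hα] at h
  have h3 : -(2 * |spikeCoef g| / hermiteOne g ^ 2) ≤ 2 * spikeCoef g / hermiteOne g ^ 2 := by
    rw [← neg_div]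
    gcongr
    linarith [neg_abs_le (spikeCoef g)]
  have h4 : α - 1 / (d : ℝ) + 2 * spikeCoef g / (hermiteOne g ^ 2 * d)
      = (d * α - 1 + 2 * spikeCoef g / hermiteOne g ^ 2) / d := by
    rw [← div_div]
    field_simp
  rw [h4]
  exact div_nonneg (by linarith) hd'.le

/-- A lower bound of `det Γ ^ (-1/2)`, independent of `d` for `ζ = 1/2`. -/
def lowerConst (g : ℝ → ℝ) (v α β ηt ζ : ℝ) (d : ℕ) : ℝ :=
  (Real.exp (isotropicExcess g v α β ηt ζ d / 2) *
    Real.sqrt (1 + isotropicExcess g v α β ηt ζ d + spikeBound g α β ηt ζ d))⁻¹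

theorem lowerConst_pos (hα : 0 < α) (hv : 0 ≤ v) (d : ℕ) : 0 < lowerConst g v α β ηt ζ d := by
  have h1 := isotropicExcess_nonneg (g := g) (β := β) (ηt := ηt) (ζ := ζ) hα hv d
  have h2 := spikeBound_nonneg (g := g) (β := β) (ηt := ηt) (ζ := ζ) hα d
  unfold lowerConst
  positivity

/-- `A - 1` is an excess divided by `d`, so `(1 + x / d) ^ (d / 2) ≤ exp(x / 2)` keeps the `d`-th
power from degenerating with the dimension when `ζ = 1/2`. -/
theorem lowerConst_le (hα : 0 < α) (hv : 0 ≤ v) (hd : 0 < d)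
    (hB : 0 ≤ covB g α β (ηt * (d : ℝ) ^ ζ) d) :
    lowerConst g v α β ηt ζ d ≤ (Real.sqrt (covA g v α β (ηt * (d : ℝ) ^ ζ) d) ^ d *
      Real.sqrt (covA g v α β (ηt * (d : ℝ) ^ ζ) d + covB g α β (ηt * (d : ℝ) ^ ζ) d))⁻¹ := by
  have hd' : (1 : ℝ) ≤ d := by exact_mod_cast hd
  have h1 := isotropicExcess_nonneg (g := g) (β := β) (ηt := ηt) (ζ := ζ) hα hv d
  have h3 := covB_le_spikeBound (g := g) (β := β) (ηt := ηt) (ζ := ζ) hα hd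
  have h4 : isotropicExcess g v α β ηt ζ d / d ≤ isotropicExcess g v α β ηt ζ d :=
    div_le_self h1 hd'
  rw [lowerConst, covA_eq hd]
  have h5 : 0 ≤ isotropicExcess g v α β ηt ζ d / d := by positivity
  have h6 : 0 < Real.sqrt (1 + isotropicExcess g v α β ηt ζ d / d) := by positivity
  have h7 : Real.sqrt (1 + isotropicExcess g v α β ηt ζ d / d) ^ d
      ≤ Real.exp (isotropicExcess g v α β ηt ζ d / 2) := by
    have h8 : Real.sqrt (1 + isotropicExcess g v α β ηt ζ d / d)
        ≤ Real.exp (isotropicExcess g v α β ηt ζ d / d / 2) := by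
      rw [Real.exp_half]
      gcongr
      linarith [Real.add_one_le_exp (isotropicExcess g v α β ηt ζ d / d)]
    calc _ ≤ Real.exp (isotropicExcess g v α β ηt ζ d / d / 2) ^ d := by gcongr
      _ = _ := by
        rw [← Real.exp_nat_mul]
        congr 1
        field_simp
  gcongr

theorem stepFactor_half (ηt : ℝ) (d : ℕ) : stepFactor ηt (1 / 2) d = ηt ^ 2 := by
  norm_num [stepFactor]

theorem lowerConst_half (g : ℝ → ℝ) (v α β ηt : ℝ) (d d' : ℕ) :
    lowerConst g v α β ηt (1 / 2) d = lowerConst g v α β ηt (1 / 2) d' := by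
  simp only [lowerConst, isotropicExcess, spikeBound, stepFactor_half]

end Coefficients

/-! ### Uniform comparison of the two operators -/

section SpikedComparison

variable {d : ℕ} {a b : ℝ}

/-- `λ_j(T₁) ≤ exp(d r² / 2) λ_j(T₀) + K exp(-κ r²)` for all `r ≥ 0`, uniformly in the direction of
the spike and in the activation function. -/
theorem exists_sortedEigenvalue_spikedOp_le (hd : 0 < d) (ha : 1 ≤ a) (hb : 0 ≤ b) (L : ℝ≥0)
    (S : ℝ) : ∃ κ K : ℝ, 0 < κ ∧ 0 ≤ K ∧ ∀ v : EuclideanSpace ℝ (Fin d), ‖v‖ = 1 →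
      ∀ (σ : ℝ → ℝ) (hσ : LipschitzWith L σ), |σ 0| ≤ S → ∀ (j : ℕ) (r : ℝ), 0 ≤ r →
        sortedEigenvalue (spikedOp hσ (a • (1 : Matrix (Fin d) (Fin d) ℝ)
            + b • Matrix.vecMulVec v.ofLp v.ofLp)) j ≤
          Real.exp (d * r ^ 2 / 2) * sortedEigenvalue (isotropicOp d hσ) j
            + K * Real.exp (-κ * r ^ 2) := by
  obtain ⟨κ, hκ, h⟩ := exists_spiked_exp_moment hd ha hb
  obtain ⟨K, hK, hv⟩ := h S L
  refine ⟨κ, inputMoment (Set.univ : Set (EuclideanSpace ℝ (Fin d))) * K, hκ,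
    mul_nonneg (inputMoment_nonneg _) hK, fun v hv1 σ hσ hS j r hr => ?_⟩
  obtain ⟨hint, hle⟩ := hv v hv1
  exact sortedEigenvalue_conjOp_le hσ (Real.exp_pos _) hr
    (spiked_restrict_le_smul_isotropic hd hv1 ha hb r) hκ.le hS hint hle j

/-- Truncation of the inputs moves the eigenvalues of `T₁` little, uniformly in the direction of the
spike and in the activation function. -/
theorem eventually_spikedOp_trunc_le (hd : 0 < d) (ha : 1 ≤ a) (hb : 0 ≤ b) (L : ℝ≥0)
    (S : ℝ) {ε : ℝ} (hε : 0 < ε) : ∀ᶠ R : ℝ in atTop,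
      ∀ v : EuclideanSpace ℝ (Fin d), ‖v‖ = 1 →
      ∀ (σ : ℝ → ℝ) (hσ : LipschitzWith L σ), |σ 0| ≤ S → ∀ j : ℕ,
        |sortedEigenvalue (spikedOp hσ (a • (1 : Matrix (Fin d) (Fin d) ℝ)
            + b • Matrix.vecMulVec v.ofLp v.ofLp)) j -
          sortedEigenvalue (spikedOpTrunc hσ (a • (1 : Matrix (Fin d) (Fin d) ℝ)
            + b • Matrix.vecMulVec v.ofLp v.ofLp) R) j| ≤ ε := by
  obtain ⟨κ, hκ, h⟩ := exists_spiked_exp_moment hd ha hb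
  obtain ⟨K, hK, hv⟩ := h S L
  have hlim : Tendsto (fun R : ℝ => K *
      (2 * Real.sqrt (inputMoment (Set.univ : Set (EuclideanSpace ℝ (Fin d)))) *
        Real.sqrt (inputMoment (Metric.ball (0 : EuclideanSpace ℝ (Fin d)) R)ᶜ))) atTop
      (nhds (K * (2 * Real.sqrt (inputMoment (Set.univ : Set (EuclideanSpace ℝ (Fin d)))) *
        Real.sqrt 0))) :=
    ((tendsto_inputMoment_compl_ball d).sqrt.const_mul _).const_mul _
  rw [Real.sqrt_zero, mul_zero, mul_zero] at hlim
  filter_upwards [hlim.eventually_le_const hε] with R hR v hv1 σ hσ hS j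
  obtain ⟨hint, hle⟩ := hv v hv1
  obtain ⟨hint', hle'⟩ := moment_le_of_exp_moment hκ.le hint hle
  exact (abs_sortedEigenvalue_conjOp_sub_truncConjOp_le hσ _ hS hint' hle' R j).trans hR

theorem eventually_isotropicOp_trunc_le (hd : 0 < d) (L : ℝ≥0) (S : ℝ) {ε : ℝ} (hε : 0 < ε) :
    ∀ᶠ R : ℝ in atTop, ∀ (σ : ℝ → ℝ) (hσ : LipschitzWith L σ), |σ 0| ≤ S → ∀ j : ℕ,
      |sortedEigenvalue (isotropicOp d hσ) j - sortedEigenvalue (isotropicOpTrunc d hσ R) j|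
        ≤ ε := by
  filter_upwards [eventually_spikedOp_trunc_le hd le_rfl le_rfl L S hε] with R hR σ hσ hS j
  -- The isotropic case is `a = 1`, `b = 0`; any unit vector may serve as direction, and one exists
  -- since `d > 0`.
  have h := hR (EuclideanSpace.single ⟨0, hd⟩ 1) (by simp) σ hσ hS j
  rwa [one_smul, zero_smul, add_zero] at h

theorem mul_sortedEigenvalue_isotropicOp_le (hd : 0 < d) (ha : 1 ≤ a) (hb : 0 ≤ b)
    {v : EuclideanSpace ℝ (Fin d)} (hv : ‖v‖ = 1) {L : ℝ≥0} {σ : ℝ → ℝ} (hσ : LipschitzWith L σ)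
    (j : ℕ) :
    (Real.sqrt a ^ d * Real.sqrt (a + b))⁻¹ * sortedEigenvalue (isotropicOp d hσ) j ≤
      sortedEigenvalue (spikedOp hσ (a • (1 : Matrix (Fin d) (Fin d) ℝ)
        + b • Matrix.vecMulVec v.ofLp v.ofLp)) j :=
  mul_sortedEigenvalue_conjOp_le hσ (by positivity) (smul_isotropic_le_spiked hd hv ha hb) j

end SpikedComparison

end

/-! ### The main theorem -/

theorem mainTheorem2
    (g : ℝ → ℝ) (Lg : ℝ≥0) (hgLip : LipschitzWith Lg g) (hgBdd : ∃ M : ℝ, ∀ t, |g t| ≤ M)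
    (hgMean : ∫ z, g z ∂(gaussianReal 0 1) = 0) (hgInfo : hermiteOne g ≠ 0)
    (noiseVar : ℝ) (hnoise : 0 ≤ noiseVar)
    (α β ηt ζ : ℝ) (hα : 0 < α) (hβ : 0 < β) (hηt : 0 < ηt) (hζ : ζ ∈ Set.Ico (1 / 2 : ℝ) 1) :
    ∃ (d₀ : ℕ) (c : ℕ → ℝ) (C : ℕ → ℝ → ℝ),
      0 < d₀ ∧ (∀ d, 0 < c d) ∧ (∀ d R, 0 < R → 0 < C d R) ∧
      (ζ = 1 / 2 → ∀ d d', c d = c d' ∧ C d = C d') ∧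
      ∀ d : ℕ, d₀ ≤ d →
        (∀ (L : ℝ≥0) (S ε : ℝ), 0 < ε → ∃ R : ℝ, 0 < R ∧
          ∀ (wstar : EuclideanSpace ℝ (Fin d)), ‖wstar‖ = 1 →
          ∀ Γ, Γ = spikedCov g noiseVar α β (ηt * (d : ℝ) ^ ζ) wstar →
          ∀ (σ : ℝ → ℝ) (hσ : LipschitzWith L σ), |σ 0| ≤ S → ∀ j : ℕ,
            |sortedEigenvalue (isotropicOp d hσ) j
                - sortedEigenvalue (isotropicOpTrunc d hσ R) j| ≤ ε ∧
            |sortedEigenvalue (spikedOp hσ Γ) j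
                - sortedEigenvalue (spikedOpTrunc hσ Γ R) j| ≤ ε ∧
            c d * sortedEigenvalue (isotropicOp d hσ) j ≤ sortedEigenvalue (spikedOp hσ Γ) j ∧
            sortedEigenvalue (spikedOp hσ Γ) j
              ≤ C d R * sortedEigenvalue (isotropicOp d hσ) j + ε) ∧
        (∀ (wstar : EuclideanSpace ℝ (Fin d)), ‖wstar‖ = 1 →
          ∀ Γ, Γ = spikedCov g noiseVar α β (ηt * (d : ℝ) ^ ζ) wstar →
          ∀ (L : ℝ≥0) (σ : ℝ → ℝ) (hσ : LipschitzWith L σ),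
            (∀ j : ℕ, sortedEigenvalue (isotropicOp d hσ) j = 0 ↔
              sortedEigenvalue (spikedOp hσ Γ) j = 0) ∧
            (fun j : ℕ => Real.log (sortedEigenvalue (spikedOp hσ Γ) j))
              =Θ[atTop] (fun j : ℕ => Real.log (sortedEigenvalue (isotropicOp d hσ) j))) := by
  obtain ⟨d₁, hd₁⟩ := exists_nat_ge ((1 + 2 * |spikeCoef g| / hermiteOne g ^ 2) / α)
  refine ⟨max 1 d₁, lowerConst g noiseVar α β ηt ζ, fun _ R => Real.exp (R ^ 2 / 2),
    by simp, lowerConst_pos hα hnoise, fun _ _ _ => Real.exp_pos _, ?_, fun d hd => ?_⟩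
  · rintro rfl d d'
    exact ⟨lowerConst_half g noiseVar α β ηt d d', rfl⟩
  have hd0 : 0 < d := (le_max_left 1 d₁).trans hd
  have hd' : (0 : ℝ) < d := by exact_mod_cast hd0
  have hdd₁ : (d₁ : ℝ) ≤ d := by exact_mod_cast (le_max_right 1 d₁).trans hd
  have hA : 1 ≤ covA g noiseVar α β (ηt * (d : ℝ) ^ ζ) d := by
    have := isotropicExcess_nonneg (g := g) (β := β) (ηt := ηt) (ζ := ζ) hα hnoise d
    rw [covA_eq hd0, le_add_iff_nonneg_right]
    positivity
  have hB : 0 ≤ covB g α β (ηt * (d : ℝ) ^ ζ) d := covB_nonneg hα hd0 (hd₁.trans hdd₁)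
  have hlower : ∀ wstar : EuclideanSpace ℝ (Fin d), ‖wstar‖ = 1 →
      ∀ (L : ℝ≥0) (σ : ℝ → ℝ) (hσ : LipschitzWith L σ) (j : ℕ),
      lowerConst g noiseVar α β ηt ζ d * sortedEigenvalue (isotropicOp d hσ) j ≤
        sortedEigenvalue (spikedOp hσ
          (spikedCov g noiseVar α β (ηt * (d : ℝ) ^ ζ) wstar)) j :=
    fun wstar hw L σ hσ j => (mul_le_mul_of_nonneg_right (lowerConst_le hα hnoise hd0 hB)
      (sortedEigenvalue_nonneg _ j)).trans (mul_sortedEigenvalue_isotropicOp_le hd0 hA hB hw hσ j)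
  refine ⟨fun L S ε hε => ?_, ?_⟩
  · obtain ⟨κ, K, hκ, -, hupper⟩ := exists_sortedEigenvalue_spikedOp_le hd0 hA hB L S
    have hlim : Tendsto (fun R : ℝ => K * Real.exp (-(κ / d) * R ^ 2)) atTop (nhds (K * 0)) :=
      (Real.tendsto_exp_atBot.comp ((tendsto_pow_atTop two_ne_zero).const_mul_atTop_of_neg
        (neg_lt_zero.2 (by positivity)))).const_mul K
    rw [mul_zero] at hlim
    -- One `R` serves three purposes: both truncations of the inputs and the weight cutoff. Each
    -- requirement holds for all large `R` and involves `σ` only through `L` and `S`.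
    obtain ⟨R, hR0, hRε, h₀, h₁⟩ := ((eventually_gt_atTop (0 : ℝ)).and
      ((hlim.eventually_le_const hε).and ((eventually_isotropicOp_trunc_le hd0 L S hε).and
        (eventually_spikedOp_trunc_le hd0 hA hB L S hε)))).exists
    refine ⟨R, hR0, ?_⟩
    rintro wstar hw _ rfl σ hσ hS j
    refine ⟨h₀ σ hσ hS j, h₁ wstar hw σ hσ hS j, hlower wstar hw L σ hσ j, ?_⟩
    -- Weights have scale `1 / √d`, so the cutoff `R / √d` makes the constant `exp(R² / 2)`, free of
    -- `d`; only the choice of `R` depends on `d`.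
    have h := hupper wstar hw σ hσ hS j (R / Real.sqrt d) (by positivity)
    rw [div_pow, Real.sq_sqrt hd'.le, mul_div_cancel₀ _ hd'.ne',
      show -κ * (R ^ 2 / d) = -(κ / d) * R ^ 2 by ring] at h
    exact h.trans (add_le_add le_rfl hRε)
  · rintro wstar hw _ rfl L σ hσ
    -- Here `σ` is fixed, so `|σ 0|` itself serves as `S`, while `r` remains free to vary with `j`.
    obtain ⟨κ, K, hκ, hK, hupper⟩ := exists_sortedEigenvalue_spikedOp_le hd0 hA hB L |σ 0|
    have h1 := hlower wstar hw L σ hσ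
    have h2 := hupper wstar hw σ hσ le_rfl
    have hc := lowerConst_pos (g := g) (β := β) (ηt := ηt) (ζ := ζ) hα hnoise d
    exact ⟨eq_zero_iff_of_comparison (fun j => sortedEigenvalue_nonneg _ j)
        (fun j => sortedEigenvalue_nonneg _ j) hc hκ h1 h2,
      isTheta_log_of_comparison (fun j => sortedEigenvalue_nonneg _ j)
        (fun j => sortedEigenvalue_nonneg _ j) (tendsto_sortedEigenvalue_conjOp hσ _)
        (tendsto_sortedEigenvalue_conjOp hσ _) hc hd' hK hκ h1 h2⟩
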